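/- Notation. For $p,q\ge 0$ let $\mathrm{C}\ell^0(p,q)$ be the even part of the real Clifford algebra of a quadratic form of signature $(p,q)$ (with orthonormal basis $e_i$, $e_i^2=\eta_i=\pm1$), let $\mathrm{C}\ell^0(n)=\mathrm{C}\ell^0(n,0)$, and let $\sigma:\mathfrak{so}(p,q)\to \mathrm{C}\ell^0(p,q)$, $\sigma(X)=\tfrac14\sum_{i,j}X_{ij}\eta_j\,e_ie_j$, be the spin representation. For each of the four maximally supersymmetric backgrounds of eleven-dimensional supergravity, the symmetry Lie algebra $\mathfrak g$ and its representation $R:\mathfrak g\to\mathrm{End}(K)$ on the $32$-dimensional real vector space $K$ of Killing spinors are as follows. 1. Minkowski: $\mathfrak g=\mathbb R^{10,1}\rtimes\mathfrak{so}(10,1)$; $K=\Delta^{10,1}$ is the $32$-dimensional real module of $\mathrm{C}\ell^0(10,1)$; translations act trivially and $\mathfrak{so}(10,1)$ acts through $\sigma$. 2. $\mathrm{AdS}_4\times S^7$: $\mathfrak g=\mathfrak{so}(3,2)\oplus\mathfrak{so}(8)$; $K=\Delta^{3,2}\otimes\Delta^8_-$, i.e. $K$ is the $32$-dimensional real module of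 $\mathrm{C}\ell^0(3,2)\otimes\mathrm{C}\ell^0(8)$ on which $1\otimes e_1\cdots e_8$ acts as $-1$; $X_A+X_S$ acts as $\sigma(X_A)\otimes 1+1\otimes\sigma(X_S)$. 3. $\mathrm{AdS}_7\times S^4$: $\mathfrak g=\mathfrak{so}(6,2)\oplus\mathfrak{so}(5)$; $K$ is the real representation underlying the tensor product over $\mathbb C$ of the quaternionic representations $\Delta^{6,2}_-$ and $\Delta^5$, i.e. the $32$-dimensional real module of $\mathrm{C}\ell^0(6,2)\otimes\mathrm{C}\ell^0(5)$ on which $e_1\cdots e_8\otimes 1$ acts as $-1$; $X_A+X_S$ acts as $\sigma(X_A)\otimes 1+1\otimes\sigma(X_S)$. 4. The maximally supersymmetric Cahen–Wallach wave with parameter $\mu\ne0$: put $\lambda_i=\mu/3$ for $i=1,2,3$ and $\lambda_i=\mu/6$ for $i=4,\dots,9$. Then $\mathfrak g=\mathfrak t\rtimes(\mathfrak{so}(3)\oplus\mathfrak{so}(6))$, where $\mathfrak t$ has basis $e_+,e_-,e_i,e_i^*$ $(1\le i\le 9)$ and nonzero brackets $[e_-,e_i]=e_i^*$, $[e_-,e_i^*]=-\lambda_i^2e_i$,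 $[e_i^*,e_j]=-\lambda_i^2\delta_{ij}e_+$, and $\mathfrak{so}(3)\oplus\mathfrak{so}(6)\subset\mathfrak{so}(9)$ rotates the $e_i$ and the $e_i^*$. $K$ is a $32$-dimensional real module of the Clifford algebra of $\mathbb R^{10,1}$ with generators $\Gamma_\pm,\Gamma_i$ satisfying $\Gamma_\pm^2=0$, $\Gamma_+\Gamma_-+\Gamma_-\Gamma_+=2$, $\Gamma_i\Gamma_j+\Gamma_j\Gamma_i=2\delta_{ij}$, $\Gamma_\pm\Gamma_i=-\Gamma_i\Gamma_\pm$. With $I=\Gamma_1\Gamma_2\Gamma_3$ and $\Pi_\pm=\tfrac12\Gamma_\pm\Gamma_\mp$, $$R(e_+)=0,\quad R(e_-)=-\tfrac{\mu}{4}I\Pi_+-\tfrac{\mu}{12}I\Pi_-,\quad R(e_i)=-\tfrac12\lambda_iI\Gamma_i\Gamma_+,\quad R(e_i^*)=-\tfrac12\lambda_i^2\Gamma_i\Gamma_+,\quad R(M_{ij})=\tfrac12\Gamma_i\Gamma_j .$$ An element $\gamma=\exp(X)$, $X\in\mathfrak g$, of the symmetry group acts on $K$ by $R(\gamma)=e^{R(X)}$.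 Theorem. In each of the four cases, for every $X\in\mathfrak g$ and $\gamma=\exp(X)$: if the space $K^\gamma=\{\psi\in K: R(\gamma)\psi=\psi\}$ of $\gamma$-invariant Killing spinors has dimension at least $31$, then $R(\gamma)=1$, i.e. $K^\gamma=K$ has dimension $32$. -/

import Mathlib

open scoped TensorProduct

attribute [local instance 100] LieRing.ofAssociativeRing

set_option linter.unusedSimpArgs false
set_option linter.unusedSectionVars false

noncomputable section

namespace MaxSusy

/-! ### Exponentials and invariants -/

section Exponential

variable {K : Type*} [AddCommGroup K] [Module ℝ K]

/-- The exponential `∑ fⁿ / n!` of an endomorphism of a finite-dimensional real vector space,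
computed in a basis (the result does not depend on the basis). -/
def endExp [FiniteDimensional ℝ K] (f : Module.End ℝ K) : Module.End ℝ K :=
  Matrix.toLin (Module.finBasis ℝ K) (Module.finBasis ℝ K)
    (NormedSpace.exp (LinearMap.toMatrix (Module.finBasis ℝ K) (Module.finBasis ℝ K) f))

/-- The subspace of vectors fixed by `g`. -/
def invariants (g : Module.End ℝ K) : Submodule ℝ K :=
  LinearMap.eqLocus g LinearMap.id

end Exponential

/-! ### The elements `¼ ∑ Xᵢⱼ ηⱼ gᵢ gⱼ` in an algebra generated by Clifford generators `gᵢ` -/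

section Quadratic

variable {ι : Type*} [Fintype ι] {A : Type*} [Ring A] [Algebra ℝ A]

/-- `¼ ∑ᵢⱼ Xᵢⱼ ηⱼ gᵢ gⱼ`. -/
def quad (η : ι → ℝ) (g : ι → A) (X : Matrix ι ι ℝ) : A :=
  (1 / 4 : ℝ) • ∑ i, ∑ j, (X i j * η j) • (g i * g j)

theorem quad_add (η : ι → ℝ) (g : ι → A) (X Y : Matrix ι ι ℝ) :
    quad η g (X + Y) = quad η g X + quad η g Y := by
  simp only [quad, Matrix.add_apply, add_mul, add_smul, Finset.sum_add_distrib, smul_add]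

theorem quad_smul (η : ι → ℝ) (g : ι → A) (c : ℝ) (X : Matrix ι ι ℝ) :
    quad η g (c • X) = c • quad η g X := by
  simp only [quad, Matrix.smul_apply, smul_eq_mul, mul_assoc, mul_smul, Finset.smul_sum]
  simp only [smul_comm c]

/-- `quad X` acts on the generators through the matrix `X`. -/
theorem quad_lie_gen [DecidableEq ι] {η : ι → ℝ} {g : ι → A} (hη : ∀ i, η i * η i = 1)
    (hg : ∀ i j, g i * g j + g j * g i = if i = j then (2 * η i) • (1 : A) else 0)
    {X : Matrix ι ι ℝ} (hX : ∀ i j, X j i * η j = -(X i j * η i)) (c : ι) :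
    quad η g X * g c - g c * quad η g X = ∑ a, X a c • g a := by
  have key : ∀ i j, (g i * g j) * g c - g c * (g i * g j)
      = (if j = c then (2 * η j) • g i else 0) - (if i = c then (2 * η i) • g j else 0) := by
    intro i j
    have h1 : (g i * g j) * g c - g c * (g i * g j)
        = g i * (g j * g c + g c * g j) - (g i * g c + g c * g i) * g j := by noncomm_ring
    rw [h1, hg, hg]
    split_ifs <;> simp
  have hs : quad η g X * g c - g c * quad η g X
      = (1 / 4 : ℝ) • ∑ i, ∑ j, (X i j * η j) • ((g i * g j) * g c - g c * (g i * g j)) := by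
    simp only [quad, smul_mul_assoc, mul_smul_comm, Finset.sum_mul, Finset.mul_sum, ← smul_sub,
      ← Finset.sum_sub_distrib]
  rw [hs]
  simp only [key, smul_sub, Finset.sum_sub_distrib, smul_ite, smul_zero, Finset.sum_ite_eq',
    Finset.mem_univ, if_true]
  rw [Finset.sum_comm (f := fun i j => if i = c then (X i j * η j) • (2 * η i) • g j else 0)]
  simp only [Finset.sum_ite_eq', Finset.mem_univ, if_true]
  rw [← smul_sub, ← Finset.sum_sub_distrib, Finset.smul_sum]
  refine Finset.sum_congr rfl fun a _ => ?_
  rw [smul_smul, smul_smul, ← sub_smul, smul_smul]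
  congr 1
  have h2 : X c a * η c = -(X a c * η a) := hX a c
  have h3 : X c a * η a * (2 * η c) = -(2 * X a c) := by
    calc X c a * η a * (2 * η c) = 2 * (X c a * η c) * η a := by ring
      _ = -(2 * X a c) * (η a * η a) := by rw [h2]; ring
      _ = _ := by rw [hη]; ring
  rw [h3]
  have h4 : X a c * η c * (2 * η c) = 2 * X a c := by
    calc X a c * η c * (2 * η c) = 2 * X a c * (η c * η c) := by ring
      _ = _ := by rw [hη]; ring
  rw [h4]; ring

theorem quad_lie [DecidableEq ι] {η : ι → ℝ} {g : ι → A} (hη : ∀ i, η i * η i = 1)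
    (hg : ∀ i j, g i * g j + g j * g i = if i = j then (2 * η i) • (1 : A) else 0)
    {X Y : Matrix ι ι ℝ} (hX : ∀ i j, X j i * η j = -(X i j * η i)) :
    quad η g (X * Y - Y * X) = quad η g X * quad η g Y - quad η g Y * quad η g X := by
  have hs : quad η g X * quad η g Y - quad η g Y * quad η g X
      = (1 / 4 : ℝ) • ∑ i, ∑ j, (Y i j * η j) • ((quad η g X * g i - g i * quad η g X) * g j
          + g i * (quad η g X * g j - g j * quad η g X)) := by
    conv_lhs => rw [quad.eq_def η g Y]
    simp only [smul_mul_assoc, mul_smul_comm, Finset.sum_mul, Finset.mul_sum, ← smul_sub,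
      ← Finset.sum_sub_distrib]
    congr 1
    refine Finset.sum_congr rfl fun i _ => Finset.sum_congr rfl fun j _ => ?_
    congr 1
    noncomm_ring
  have h1 : ∑ i, ∑ j, ((X * Y) i j * η j) • (g i * g j)
      = ∑ i, ∑ j, (Y i j * η j) • ((∑ a, X a i • g a) * g j) := by
    simp only [Matrix.mul_apply, Finset.sum_mul, Finset.sum_smul, Finset.smul_sum,
      smul_mul_assoc, smul_smul]
    have e1 : ∀ a : ι, ∑ j, ∑ i, (X a i * Y i j * η j) • (g a * g j)
        = ∑ i, ∑ j, (X a i * Y i j * η j) • (g a * g j) := fun a => Finset.sum_comm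
    have e2 : ∀ i : ι, ∑ j, ∑ a, (Y i j * η j * X a i) • (g a * g j)
        = ∑ a, ∑ j, (Y i j * η j * X a i) • (g a * g j) := fun i => Finset.sum_comm
    simp only [e1, e2]
    rw [Finset.sum_comm]
    refine Finset.sum_congr rfl fun i _ => Finset.sum_congr rfl fun a _ =>
      Finset.sum_congr rfl fun j _ => ?_
    congr 1; ring
  have h2 : ∑ i, ∑ j, ((Y * X) i j * η j) • (g i * g j)
      = -∑ i, ∑ j, (Y i j * η j) • (g i * ∑ a, X a j • g a) := by
    simp only [Matrix.mul_apply, Finset.sum_mul, Finset.mul_sum, Finset.sum_smul, Finset.smul_sum,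
      mul_smul_comm, smul_smul, ← Finset.sum_neg_distrib]
    have e1 : ∀ i : ι, ∑ j, ∑ a, (Y i j * η j * X a j) • (g i * g a)
        = ∑ a, ∑ j, (Y i j * η j * X a j) • (g i * g a) := fun i => Finset.sum_comm
    simp only [Finset.sum_neg_distrib, e1]
    simp only [← Finset.sum_neg_distrib]
    refine Finset.sum_congr rfl fun i _ => Finset.sum_congr rfl fun a _ =>
      Finset.sum_congr rfl fun j _ => ?_
    rw [← neg_smul]
    congr 1
    have h2 : X a j * η a = -(X j a * η j) := hX j a
    calc Y i j * X j a * η a = -(Y i j * -(X j a * η j) * η j * η a) := by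
          rw [show -(Y i j * -(X j a * η j) * η j * η a)
            = Y i j * X j a * η a * (η j * η j) by ring, hη]; ring
      _ = -(Y i j * η j * X a j * (η a * η a)) := by rw [← h2]; ring
      _ = _ := by rw [hη]; ring
  rw [hs]
  simp only [quad_lie_gen hη hg hX, smul_add, Finset.sum_add_distrib]
  have h4 : ∑ i, ∑ j, (Y i j * η j) • (g i * ∑ a, X a j • g a)
      = -∑ i, ∑ j, ((Y * X) i j * η j) • (g i * g j) := by rw [h2, neg_neg]
  rw [← h1, h4]
  have h3 : quad η g (X * Y - Y * X) = quad η g (X * Y) + quad η g ((-1 : ℝ) • (Y * X)) := by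
    rw [← quad_add, neg_one_smul, sub_eq_add_neg]
  rw [h3, quad_smul, quad, quad]
  module

end Quadratic

/-! ### Orthogonal Lie algebras and the spin representation -/

/-- The diagonal of the Minkowski-type metric with `p` entries `+1` followed by `q` entries `-1`. -/
def signature (p q : ℕ) (i : Fin (p + q)) : ℝ := if (i : ℕ) < p then 1 else -1

theorem signature_mul_self (p q : ℕ) (i : Fin (p + q)) :
    signature p q i * signature p q i = 1 := by
  unfold signature; split_ifs <;> norm_num

/-- The quadratic form `x₁² + ⋯ + x_p² - x_{p+1}² - ⋯ - x_{p+q}²` on `ℝ^{p+q}`. -/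
abbrev form (p q : ℕ) : QuadraticForm ℝ (Fin (p + q) → ℝ) :=
  QuadraticMap.weightedSumSquares ℝ (signature p q)

/-- `𝔰𝔬(p,q)`: the matrices `X` with `Xᵀ J = -J X`, where `J` is the diagonal metric. -/
abbrev so (p q : ℕ) : LieSubalgebra ℝ (Matrix (Fin (p + q)) (Fin (p + q)) ℝ) :=
  skewAdjointMatricesLieSubalgebra (Matrix.diagonal (signature p q))

theorem so_skew {p q : ℕ} (X : so p q) (i j : Fin (p + q)) :
    X.1 j i * signature p q j = -(X.1 i j * signature p q i) := by
  have h : X.1.transpose * Matrix.diagonal (signature p q)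
      = Matrix.diagonal (signature p q) * (-X.1) := by
    have := X.2
    rw [mem_skewAdjointMatricesLieSubalgebra, mem_skewAdjointMatricesSubmodule] at this
    exact this
  have h2 := congrFun (congrFun h i) j
  simpa [Matrix.mul_diagonal, Matrix.diagonal_mul, mul_comm] using h2

/-- The even Clifford algebra `Cℓ⁰(p,q)`, which contains `Spin(p,q)`. (It is the same algebra for
the two sign conventions `v² = ±Q(v)`.) -/
abbrev EvenCl (p q : ℕ) : Type := CliffordAlgebra.even (form p q)

/-- The standard basis vectors. -/
abbrev basisVec {n : ℕ} (i : Fin n) : Fin n → ℝ := Pi.single i 1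

/-- The product `eᵢ eⱼ` in the even Clifford algebra. -/
abbrev ee {p q : ℕ} (i j : Fin (p + q)) : EvenCl p q :=
  (CliffordAlgebra.even.ι (form p q)).bilin (basisVec i) (basisVec j)

theorem clifford_rel (p q : ℕ) (i j : Fin (p + q)) :
    CliffordAlgebra.ι (form p q) (basisVec i) * CliffordAlgebra.ι (form p q) (basisVec j)
      + CliffordAlgebra.ι (form p q) (basisVec j) * CliffordAlgebra.ι (form p q) (basisVec i)
    = if i = j then (2 * signature p q i) • (1 : CliffordAlgebra (form p q)) else 0 := by
  rw [CliffordAlgebra.ι_mul_ι_add_swap, Algebra.algebraMap_eq_smul_one]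
  have h : QuadraticMap.polar (form p q) (basisVec i) (basisVec j)
      = if i = j then 2 * signature p q i else 0 := by
    simp only [QuadraticMap.polar, QuadraticMap.weightedSumSquares_apply, ← Finset.sum_sub_distrib]
    rw [Finset.sum_eq_single i]
    · by_cases hij : i = j
      · subst hij; simp; ring
      · simp [hij]
    · intro b _ hb
      simp [Pi.single_apply, hb]
    · simp
  rw [h]; split_ifs <;> simp

theorem coe_quad (p q : ℕ) (X : so p q) :
    (((1 / 4 : ℝ) • ∑ i, ∑ j, (X.1 i j * signature p q j) • ee i j : EvenCl p q) :
      CliffordAlgebra (form p q))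
    = quad (signature p q) (fun i => CliffordAlgebra.ι (form p q) (basisVec i)) X.1 := by
  simp only [quad, Subalgebra.coe_smul, AddSubmonoidClass.coe_finsetSum]
  rfl

/-- The spin representation `𝔰𝔬(p,q) → Cℓ⁰(p,q)`, `X ↦ ¼ ∑ Xᵢⱼ ηⱼ eᵢ eⱼ`. It is normalised by
`[spin X, v] = X v` for vectors `v`; the rotation generator of the `ij`-plane goes to `½ eᵢ eⱼ`. -/
def spin (p q : ℕ) : so p q →ₗ⁅ℝ⁆ EvenCl p q where
  toFun X := (1 / 4 : ℝ) • ∑ i, ∑ j, (X.1 i j * signature p q j) • ee i j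
  map_add' X Y := by
    apply Subtype.ext
    rw [Subalgebra.coe_add, coe_quad, coe_quad, coe_quad]
    exact quad_add _ _ _ _
  map_smul' c X := by
    apply Subtype.ext
    exact (coe_quad p q (c • X)).trans
      ((quad_smul _ _ _ _).trans (congrArg (c • ·) (coe_quad p q X).symm))
  map_lie' {X Y} := by
    apply Subtype.ext
    rw [LieRing.of_associative_ring_bracket, Subalgebra.coe_sub, Subalgebra.coe_mul,
      Subalgebra.coe_mul, coe_quad, coe_quad, coe_quad]
    exact quad_lie (signature_mul_self p q) (clifford_rel p q) (so_skew X)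

/-- For `p + q = 8`, the volume element `e₁ e₂ ⋯ e₈`. -/
def volume8 {p q : ℕ} (h : p + q = 8) : EvenCl p q :=
  let e : Fin 8 → Fin (p + q) := Fin.cast h.symm
  ee (e 0) (e 1) * ee (e 2) (e 3) * ee (e 4) (e 5) * ee (e 6) (e 7)

/-! ### Minkowski spacetime -/

/-- The infinitesimal translations `ℝ^{10,1}`, an abelian Lie algebra. -/
abbrev Translations : Type := Fin (10 + 1) → ℝ

theorem translations_abelian (u v : Translations) : ⁅u, v⁆ = 0 := by
  funext i
  change u i * v i - v i * u i = 0
  ring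

/-- A matrix as a derivation of the abelian Lie algebra of translations. -/
def translationDerivation (X : Matrix (Fin (10 + 1)) (Fin (10 + 1)) ℝ) :
    LieDerivation ℝ Translations Translations where
  toLinearMap := Matrix.mulVecLin X
  leibniz' a b := by simp only [translations_abelian, map_zero, sub_zero]

/-- `𝔰𝔬(10,1)` acting on the translations. -/
def rotateTranslations : so 10 1 →ₗ⁅ℝ⁆ LieDerivation ℝ Translations Translations where
  toFun X := translationDerivation X.1
  map_add' X Y := by
    ext1 v
    change (X.1 + Y.1).mulVec v = X.1.mulVec v + Y.1.mulVec v
    exact Matrix.add_mulVec _ _ _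
  map_smul' c X := by
    ext1 v
    change (c • X.1).mulVec v = c • X.1.mulVec v
    exact Matrix.smul_mulVec _ _ _
  map_lie' {X Y} := by
    ext1 v
    rw [LieDerivation.commutator_apply]
    change (X.1 * Y.1 - Y.1 * X.1).mulVec v = X.1.mulVec (Y.1.mulVec v) - Y.1.mulVec (X.1.mulVec v)
    rw [Matrix.sub_mulVec, Matrix.mulVec_mulVec, Matrix.mulVec_mulVec]

/-- The symmetry Lie algebra `ℝ^{10,1} ⋊ 𝔰𝔬(10,1)` of eleven-dimensional Minkowski spacetime. -/
abbrev Poincare : Type := LieAlgebra.SemiDirectSum Translations (so 10 1) rotateTranslations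

section Representations

variable {K : Type*} [AddCommGroup K] [Module ℝ K]

/-- The Poincaré algebra acting on spinors: translations act trivially and `𝔰𝔬(10,1)` acts through
the spin representation on the `Cℓ⁰(10,1)`-module `K`. Since `Cℓ⁰(10,1) ≅ Mat₃₂(ℝ)`, there is, up to
isomorphism, exactly one such `K` of real dimension `32`: the real spinor module `Δ^{10,1}`. -/
def minkowskiRep (ρ : EvenCl 10 1 →ₐ[ℝ] Module.End ℝ K) : Poincare →ₗ⁅ℝ⁆ Module.End ℝ K :=
  (ρ : EvenCl 10 1 →ₗ⁅ℝ⁆ Module.End ℝ K).comp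
    ((spin 10 1).comp (LieAlgebra.SemiDirectSum.projr rotateTranslations))

/-! ### Freund--Rubin backgrounds -/

/-- `(X, Y) ↦ f X ⊗ 1 + 1 ⊗ g Y`. -/
def tensorSum {L M A B : Type*} [LieRing L] [LieAlgebra ℝ L] [LieRing M] [LieAlgebra ℝ M]
    [Ring A] [Algebra ℝ A] [Ring B] [Algebra ℝ B] (f : L →ₗ⁅ℝ⁆ A) (g : M →ₗ⁅ℝ⁆ B) :
    (L × M) →ₗ⁅ℝ⁆ (A ⊗[ℝ] B) where
  toFun X := f X.1 ⊗ₜ 1 + 1 ⊗ₜ g X.2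
  map_add' X Y := by
    simp only [Prod.fst_add, Prod.snd_add, map_add, TensorProduct.add_tmul, TensorProduct.tmul_add]
    abel
  map_smul' c X := by
    simp only [RingHom.id_apply, Prod.smul_fst, Prod.smul_snd, map_smul, smul_add,
      TensorProduct.smul_tmul', TensorProduct.tmul_smul]
  map_lie' {X Y} := by
    change f ⁅X.1, Y.1⁆ ⊗ₜ[ℝ] (1 : B) + (1 : A) ⊗ₜ[ℝ] g ⁅X.2, Y.2⁆ = _
    simp only [LieHom.map_lie, LieRing.of_associative_ring_bracket, mul_add, add_mul,
      Algebra.TensorProduct.tmul_mul_tmul, mul_one, one_mul, TensorProduct.sub_tmul,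
      TensorProduct.tmul_sub]
    abel

/-- The Lie algebra `𝔰𝔬(p,2) ⊕ 𝔰𝔬(n)` acting on a module `K` of `Cℓ⁰(p,2) ⊗ Cℓ⁰(n)` by
`X_A + X_S ↦ spin X_A ⊗ 1 + 1 ⊗ spin X_S`.

For `(p,n) = (3,8)` one has `Cℓ⁰(3,2) ≅ Mat₄(ℝ)`, and the summand of `Cℓ⁰(8)` in which the volume
element is `-1` is `Mat₈(ℝ)`; so the only `32`-dimensional real `K` on which that volume element is
`-1` is `Δ^{3,2} ⊗ Δ^8_-`. For `(p,n) = (6,5)` the summand of `Cℓ⁰(6,2)` in which the volume element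
is `-1` is `Mat₄(ℍ)` and `Cℓ⁰(5) ≅ Mat₂(ℍ)`, with `Mat₄(ℍ) ⊗ Mat₂(ℍ) ≅ Mat₃₂(ℝ)`; so the only
`32`-dimensional real `K` on which that volume element is `-1` is the real representation underlying
the tensor product over `ℂ` of the quaternionic representations `Δ^{6,2}_-` and `Δ^5`. -/
def freundRubinRep {p n : ℕ} (ρ : EvenCl p 2 ⊗[ℝ] EvenCl n 0 →ₐ[ℝ] Module.End ℝ K) :
    (so p 2 × so n 0) →ₗ⁅ℝ⁆ Module.End ℝ K :=
  (ρ : EvenCl p 2 ⊗[ℝ] EvenCl n 0 →ₗ⁅ℝ⁆ Module.End ℝ K).comp (tensorSum (spin p 2) (spin n 0))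


end Representations

/-! ### The maximally supersymmetric Cahen--Wallach wave -/

/-- Labels of the nine transverse directions, split as `3 + 6`. -/
abbrev Transverse : Type := Fin 3 ⊕ Fin 6

/-- The frequencies: `μ/3` in the first three directions and `μ/6` in the other six. -/
def freq (μ : ℝ) : Transverse → ℝ := Sum.elim (fun _ => μ / 3) (fun _ => μ / 6)

/-- The `20`-dimensional transvection algebra with basis `e₊, e₋, eᵢ, eᵢ*`; an element is
`plus e₊ + minus e₋ + ∑ e i eᵢ + ∑ eStar i eᵢ*`. -/
@[ext] structure CahenWallach (μ : ℝ) where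
  plus : ℝ
  minus : ℝ
  e : Transverse → ℝ
  eStar : Transverse → ℝ

namespace CahenWallach

variable {μ : ℝ}

def toProd : CahenWallach μ ≃ ℝ × ℝ × (Transverse → ℝ) × (Transverse → ℝ) where
  toFun X := (X.plus, X.minus, X.e, X.eStar)
  invFun p := ⟨p.1, p.2.1, p.2.2.1, p.2.2.2⟩
  left_inv _ := rfl
  right_inv _ := rfl

instance : AddCommGroup (CahenWallach μ) := toProd.addCommGroup

instance : Module ℝ (CahenWallach μ) := toProd.module ℝ

@[simp] theorem plus_zero : (0 : CahenWallach μ).plus = 0 := rfl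
@[simp] theorem minus_zero : (0 : CahenWallach μ).minus = 0 := rfl
@[simp] theorem e_zero : (0 : CahenWallach μ).e = 0 := rfl
@[simp] theorem eStar_zero : (0 : CahenWallach μ).eStar = 0 := rfl
@[simp] theorem plus_add (X Y : CahenWallach μ) : (X + Y).plus = X.plus + Y.plus := rfl
@[simp] theorem minus_add (X Y : CahenWallach μ) : (X + Y).minus = X.minus + Y.minus := rfl
@[simp] theorem e_add (X Y : CahenWallach μ) : (X + Y).e = X.e + Y.e := rfl
@[simp] theorem eStar_add (X Y : CahenWallach μ) : (X + Y).eStar = X.eStar + Y.eStar := rfl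
@[simp] theorem plus_sub (X Y : CahenWallach μ) : (X - Y).plus = X.plus - Y.plus := rfl
@[simp] theorem minus_sub (X Y : CahenWallach μ) : (X - Y).minus = X.minus - Y.minus := rfl
@[simp] theorem e_sub (X Y : CahenWallach μ) : (X - Y).e = X.e - Y.e := rfl
@[simp] theorem eStar_sub (X Y : CahenWallach μ) : (X - Y).eStar = X.eStar - Y.eStar := rfl
@[simp] theorem plus_smul (c : ℝ) (X : CahenWallach μ) : (c • X).plus = c * X.plus := rfl
@[simp] theorem minus_smul (c : ℝ) (X : CahenWallach μ) : (c • X).minus = c * X.minus := rfl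
@[simp] theorem e_smul (c : ℝ) (X : CahenWallach μ) : (c • X).e = c • X.e := rfl
@[simp] theorem eStar_smul (c : ℝ) (X : CahenWallach μ) : (c • X).eStar = c • X.eStar := rfl

/-- The nonzero brackets are `[e₋, eᵢ] = eᵢ*`, `[e₋, eᵢ*] = -λᵢ² eᵢ`, `[eᵢ*, eⱼ] = -λᵢ² δᵢⱼ e₊`. -/
instance : Bracket (CahenWallach μ) (CahenWallach μ) where
  bracket X Y :=
    { plus := ∑ i, -(freq μ i ^ 2) * (X.eStar i * Y.e i - Y.eStar i * X.e i)
      minus := 0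
      e := fun i => -(freq μ i ^ 2) * (X.minus * Y.eStar i - Y.minus * X.eStar i)
      eStar := fun i => X.minus * Y.e i - Y.minus * X.e i }

theorem lie_plus (X Y : CahenWallach μ) :
    ⁅X, Y⁆.plus = ∑ i, -(freq μ i ^ 2) * (X.eStar i * Y.e i - Y.eStar i * X.e i) := rfl
theorem lie_minus (X Y : CahenWallach μ) : ⁅X, Y⁆.minus = 0 := rfl
theorem lie_e (X Y : CahenWallach μ) (i : Transverse) :
    ⁅X, Y⁆.e i = -(freq μ i ^ 2) * (X.minus * Y.eStar i - Y.minus * X.eStar i) := rfl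
theorem lie_eStar (X Y : CahenWallach μ) (i : Transverse) :
    ⁅X, Y⁆.eStar i = X.minus * Y.e i - Y.minus * X.e i := rfl

instance : LieRing (CahenWallach μ) where
  add_lie X Y Z := by
    ext <;> simp only [lie_plus, lie_minus, lie_e, lie_eStar, plus_add, minus_add, e_add,
      eStar_add, Pi.add_apply, ← Finset.sum_add_distrib, add_zero] <;>
      first | ring1 | exact Finset.sum_congr rfl fun i _ => by ring
  lie_add X Y Z := by
    ext <;> simp only [lie_plus, lie_minus, lie_e, lie_eStar, plus_add, minus_add, e_add,
      eStar_add, Pi.add_apply, ← Finset.sum_add_distrib, add_zero] <;>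
      first | ring1 | exact Finset.sum_congr rfl fun i _ => by ring
  lie_self X := by
    ext <;> simp [lie_plus, lie_minus, lie_e, lie_eStar]
  leibniz_lie X Y Z := by
    ext <;> simp only [lie_plus, lie_minus, lie_e, lie_eStar, plus_add, minus_add, e_add,
      eStar_add, Pi.add_apply, ← Finset.sum_add_distrib, add_zero] <;>
      first | ring1 | exact Finset.sum_congr rfl fun i _ => by ring

instance : LieAlgebra ℝ (CahenWallach μ) where
  lie_smul c X Y := by
    ext <;> simp only [lie_plus, lie_minus, lie_e, lie_eStar, plus_smul, minus_smul, e_smul,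
      eStar_smul, Pi.smul_apply, smul_eq_mul, Finset.mul_sum, mul_zero] <;>
      first | ring1 | exact Finset.sum_congr rfl fun i _ => by ring

end CahenWallach

/-- `𝔰𝔬(3) ⊕ 𝔰𝔬(6)`. -/
abbrev Rotations : Type :=
  LieAlgebra.Orthogonal.so (Fin 3) ℝ × LieAlgebra.Orthogonal.so (Fin 6) ℝ

/-- `𝔰𝔬(3) ⊕ 𝔰𝔬(6)` as block-diagonal matrices in `𝔰𝔬(9)`. -/
def blockMatrix (X : Rotations) : Matrix Transverse Transverse ℝ :=
  Matrix.fromBlocks X.1.1 0 0 X.2.1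

theorem blockMatrix_add (X Y : Rotations) :
    blockMatrix (X + Y) = blockMatrix X + blockMatrix Y := by
  simp [blockMatrix, Matrix.fromBlocks_add]

theorem blockMatrix_smul (c : ℝ) (X : Rotations) :
    blockMatrix (c • X) = c • blockMatrix X := by
  simp [blockMatrix, Matrix.fromBlocks_smul]

theorem blockMatrix_lie (X Y : Rotations) :
    blockMatrix ⁅X, Y⁆ = blockMatrix X * blockMatrix Y - blockMatrix Y * blockMatrix X := by
  change Matrix.fromBlocks (X.1.1 * Y.1.1 - Y.1.1 * X.1.1) 0 0 (X.2.1 * Y.2.1 - Y.2.1 * X.2.1) = _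
  ext (i | i) (j | j) <;> simp [blockMatrix, Matrix.fromBlocks_multiply]

theorem blockMatrix_skew (X : Rotations) (i j : Transverse) :
    blockMatrix X j i = -blockMatrix X i j := by
  have h1 : X.1.1.transpose = -X.1.1 := (LieAlgebra.Orthogonal.mem_so _ _ _).1 X.1.2
  have h2 : X.2.1.transpose = -X.2.1 := (LieAlgebra.Orthogonal.mem_so _ _ _).1 X.2.2
  rcases i with i | i <;> rcases j with j | j <;> simp [blockMatrix]
  · exact congrFun (congrFun h1 i) j
  · exact congrFun (congrFun h2 i) j

theorem blockMatrix_freq (μ : ℝ) (X : Rotations) (i j : Transverse) :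
    blockMatrix X i j * freq μ j = freq μ i * blockMatrix X i j := by
  rcases i with i | i <;> rcases j with j | j <;> simp [blockMatrix, freq, mul_comm]

theorem blockMatrix_mulVec_freq (μ : ℝ) (X : Rotations) (v : Transverse → ℝ) (i : Transverse) :
    (blockMatrix X).mulVec (fun j => -(freq μ j ^ 2) * v j) i
      = -(freq μ i ^ 2) * (blockMatrix X).mulVec v i := by
  simp only [Matrix.mulVec, dotProduct, Finset.mul_sum]
  refine Finset.sum_congr rfl fun j _ => ?_
  have h := blockMatrix_freq μ X i j
  calc blockMatrix X i j * (-(freq μ j ^ 2) * v j)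
      = -(blockMatrix X i j * freq μ j) * freq μ j * v j := by ring
    _ = -(freq μ i * blockMatrix X i j) * freq μ j * v j := by rw [h]
    _ = -freq μ i * (blockMatrix X i j * freq μ j) * v j := by ring
    _ = -freq μ i * (freq μ i * blockMatrix X i j) * v j := by rw [h]
    _ = _ := by ring

theorem blockMatrix_adjoint (μ : ℝ) (X : Rotations) (u v : Transverse → ℝ) :
    ∑ i, -(freq μ i ^ 2) * (u i * (blockMatrix X).mulVec v i)
      = -∑ i, -(freq μ i ^ 2) * ((blockMatrix X).mulVec u i * v i) := by
  have h1 : ∀ i, -(freq μ i ^ 2) * ((blockMatrix X).mulVec u i * v i)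
      = ∑ j, blockMatrix X i j * (-(freq μ j ^ 2) * u j) * v i := fun i => by
    rw [← mul_assoc, ← blockMatrix_mulVec_freq, Matrix.mulVec, dotProduct, Finset.sum_mul]
  have h2 : ∀ i, -(freq μ i ^ 2) * (u i * (blockMatrix X).mulVec v i)
      = ∑ j, -(blockMatrix X j i * (-(freq μ i ^ 2) * u i) * v j) := fun i => by
    rw [Matrix.mulVec, dotProduct, Finset.mul_sum, Finset.mul_sum]
    refine Finset.sum_congr rfl fun j _ => ?_
    rw [blockMatrix_skew X i j]; ring
  simp only [h1, h2]
  rw [Finset.sum_comm]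
  simp only [Finset.sum_neg_distrib]

open Matrix in
/-- `𝔰𝔬(3) ⊕ 𝔰𝔬(6)` acting on the transvection algebra by rotating the `eᵢ` and the `eᵢ*`. -/
def rotationDerivation (μ : ℝ) (X : Rotations) :
    LieDerivation ℝ (CahenWallach μ) (CahenWallach μ) where
  toFun Y := ⟨0, 0, blockMatrix X *ᵥ Y.e, blockMatrix X *ᵥ Y.eStar⟩
  map_add' Y Z := by ext <;> simp [Matrix.mulVec_add]
  map_smul' c Y := by ext <;> simp [Matrix.mulVec_smul]
  leibniz' Y Z := by
    change (⟨0, 0, blockMatrix X *ᵥ ⁅Y, Z⁆.e, blockMatrix X *ᵥ ⁅Y, Z⁆.eStar⟩ : CahenWallach μ)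
      = ⁅Y, (⟨0, 0, blockMatrix X *ᵥ Z.e, blockMatrix X *ᵥ Z.eStar⟩ : CahenWallach μ)⁆
        - ⁅Z, (⟨0, 0, blockMatrix X *ᵥ Y.e, blockMatrix X *ᵥ Y.eStar⟩ : CahenWallach μ)⁆
    ext i
    · simp only [CahenWallach.plus_sub, CahenWallach.lie_plus]
      have h1 := blockMatrix_adjoint μ X Y.eStar Z.e
      have h2 := blockMatrix_adjoint μ X Z.eStar Y.e
      simp only [mul_sub, Finset.sum_sub_distrib]
      linarith
    · simp [CahenWallach.lie_minus]
    · have h : ⁅Y, Z⁆.e = fun i => -(freq μ i ^ 2)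
          * (Y.minus • Z.eStar - Z.minus • Y.eStar : Transverse → ℝ) i := rfl
      rw [h]
      change (blockMatrix X *ᵥ fun i => -(freq μ i ^ 2)
          * (Y.minus • Z.eStar - Z.minus • Y.eStar : Transverse → ℝ) i) i = _
      rw [blockMatrix_mulVec_freq]
      simp only [CahenWallach.e_sub, CahenWallach.lie_e, Pi.sub_apply,
        Matrix.mulVec_sub, Matrix.mulVec_smul, Pi.smul_apply, smul_eq_mul]
      ring
    · have h : ⁅Y, Z⁆.eStar = Y.minus • Z.e - Z.minus • Y.e := rfl
      rw [h]
      simp only [CahenWallach.eStar_sub, CahenWallach.lie_eStar, Pi.sub_apply,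
        Matrix.mulVec_sub, Matrix.mulVec_smul, Pi.smul_apply, smul_eq_mul]
      ring

/-- `𝔰𝔬(3) ⊕ 𝔰𝔬(6)` acting by derivations of the transvection algebra. -/
def rotate (μ : ℝ) : Rotations →ₗ⁅ℝ⁆ LieDerivation ℝ (CahenWallach μ) (CahenWallach μ) where
  toFun := rotationDerivation μ
  map_add' X Y := by
    ext1 Z
    apply CahenWallach.ext <;> simp [rotationDerivation, blockMatrix_add, Matrix.add_mulVec]
  map_smul' c X := by
    ext1 Z
    apply CahenWallach.ext <;> simp [rotationDerivation, blockMatrix_smul, Matrix.smul_mulVec]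
  map_lie' {X Y} := by
    ext1 Z
    rw [LieDerivation.commutator_apply]
    change (⟨0, 0, (blockMatrix ⁅X, Y⁆).mulVec Z.e, (blockMatrix ⁅X, Y⁆).mulVec Z.eStar⟩ :
      CahenWallach μ) = _
    rw [blockMatrix_lie]
    apply CahenWallach.ext <;>
      simp [rotationDerivation, Matrix.sub_mulVec, Matrix.mulVec_mulVec]

/-- The symmetry Lie algebra `𝔤 ⋊ (𝔰𝔬(3) ⊕ 𝔰𝔬(6))` of the wave. -/
abbrev WaveAlgebra (μ : ℝ) : Type :=
  LieAlgebra.SemiDirectSum (CahenWallach μ) Rotations (rotate μ)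

/-- The Lorentzian form `2 x₊ x₋ + ∑ xᵢ²` on `ℝ^{10,1}`, coordinates `(x₊, x₋, x)`. -/
def wittForm : QuadraticForm ℝ (ℝ × ℝ × (Transverse → ℝ)) :=
  (2 : ℝ) • QuadraticMap.linMulLin (LinearMap.fst ℝ ℝ (ℝ × (Transverse → ℝ)))
      (LinearMap.fst ℝ ℝ (Transverse → ℝ) ∘ₗ LinearMap.snd ℝ ℝ (ℝ × (Transverse → ℝ)))
    + (QuadraticMap.weightedSumSquares ℝ (fun _ : Transverse => (1 : ℝ))).comp
      (LinearMap.snd ℝ ℝ (Transverse → ℝ) ∘ₗ LinearMap.snd ℝ ℝ (ℝ × (Transverse → ℝ)))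

theorem wittForm_apply (v : ℝ × ℝ × (Transverse → ℝ)) :
    wittForm v = 2 * (v.1 * v.2.1) + ∑ i, v.2.2 i * v.2.2 i := by
  change (2 : ℝ) • (v.1 * v.2.1)
    + QuadraticMap.weightedSumSquares ℝ (fun _ : Transverse => (1 : ℝ)) v.2.2 = _
  simp [QuadraticMap.weightedSumSquares_apply]

/-- The Clifford algebra of `ℝ^{10,1}`, with `v² = Q(v)`, in a Witt basis. -/
abbrev WaveCl : Type := CliffordAlgebra wittForm

/-- `Γ₊`, with `Γ₊² = 0`. -/
def gammaPlus : WaveCl := CliffordAlgebra.ι wittForm (1, 0, 0)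

/-- `Γ₋`, with `Γ₋² = 0` and `Γ₊ Γ₋ + Γ₋ Γ₊ = 2`. -/
def gammaMinus : WaveCl := CliffordAlgebra.ι wittForm (0, 1, 0)

/-- `Γᵢ`, with `Γᵢ² = 1`. -/
def gamma (i : Transverse) : WaveCl := CliffordAlgebra.ι wittForm (0, 0, Pi.single i 1)

section WaveRelations

variable {A : Type*} [Ring A] [Algebra ℝ A]

/-- The relations between Clifford generators in a Witt basis. -/
structure WittRelations (P M : A) (g : Transverse → A) : Prop where
  PP : P * P = 0
  MM : M * M = 0
  MP : M * P = 2 - P * M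
  Pg : ∀ i, P * g i = -(g i * P)
  Mg : ∀ i, M * g i = -(g i * M)
  gg : ∀ i j, g i * g j + g j * g i = if i = j then (2 * 1 : ℝ) • (1 : A) else 0

/-- The product `g₁ g₂ g₃` over the first three transverse directions. -/
def triple (g : Transverse → A) : A := g (Sum.inl 0) * g (Sum.inl 1) * g (Sum.inl 2)

/-- The image of `e₋`, `-(μ/4) I Π₊ - (μ/12) I Π₋`, where `I = g₁ g₂ g₃`, `Π₊ = ½ P M`
and `Π₋ = ½ M P`. -/
def imMinus (μ : ℝ) (P M : A) (g : Transverse → A) : A :=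
  -(μ / 4) • (triple g * ((1 / 2 : ℝ) • (P * M))) - (μ / 12) • (triple g * ((1 / 2 : ℝ) • (M * P)))

/-- The image of `eᵢ`, `-½ λᵢ I gᵢ P`. -/
def imE (μ : ℝ) (P : A) (g : Transverse → A) (i : Transverse) : A :=
  (-(1 / 2) * freq μ i) • (triple g * g i * P)

/-- The image of `eᵢ*`, `-½ λᵢ² gᵢ P`. -/
def imEStar (μ : ℝ) (P : A) (g : Transverse → A) (i : Transverse) : A :=
  (-(1 / 2) * freq μ i ^ 2) • (g i * P)

/-- `+1` in the first three directions, `-1` in the other six. -/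
def sgn : Transverse → ℝ := Sum.elim (fun _ => 1) (fun _ => -1)

variable {P M : A} {g : Transverse → A}

theorem anti_tail {a b : A} (h : a * b = -(b * a)) (x : A) : a * (b * x) = -(b * (a * x)) := by
  rw [← mul_assoc, h, neg_mul, mul_assoc]

namespace WittRelations

variable (μ : ℝ)

theorem g_sq (h : WittRelations P M g) (i : Transverse) : g i * g i = 1 := by
  have := h.gg i i
  simp only [if_true] at this
  have h2 : (2 : ℝ) • (g i * g i) = (2 : ℝ) • (1 : A) := by rw [two_smul, this]; simp
  exact (smul_right_injective A (two_ne_zero (α := ℝ))) h2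

theorem g_anti (h : WittRelations P M g) {i j : Transverse} (hij : i ≠ j) :
    g i * g j = -(g j * g i) := by
  have := h.gg i j
  rw [if_neg hij] at this
  exact eq_neg_of_add_eq_zero_left this

theorem P_triple (h : WittRelations P M g) : P * triple g = -(triple g * P) := by
  simp only [triple, mul_assoc, h.Pg, anti_tail (h.Pg _), mul_neg, neg_neg]

theorem M_triple (h : WittRelations P M g) : M * triple g = -(triple g * M) := by
  simp only [triple, mul_assoc, h.Mg, anti_tail (h.Mg _), mul_neg, neg_neg]

theorem g_tail (h : WittRelations P M g) (i : Transverse) (x : A) : g i * (g i * x) = x := by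
  rw [← mul_assoc, h.g_sq, one_mul]

theorem triple_sq (h : WittRelations P M g) : triple g * triple g = -1 := by
  have h10 : g (Sum.inl 1) * g (Sum.inl 0) = -(g (Sum.inl 0) * g (Sum.inl 1)) :=
    h.g_anti (by simp)
  have h20 : g (Sum.inl 2) * g (Sum.inl 0) = -(g (Sum.inl 0) * g (Sum.inl 2)) :=
    h.g_anti (by simp)
  have h21 : g (Sum.inl 2) * g (Sum.inl 1) = -(g (Sum.inl 1) * g (Sum.inl 2)) :=
    h.g_anti (by simp)
  simp only [triple, mul_assoc, anti_tail h10, anti_tail h20, anti_tail h21, mul_neg, neg_neg,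
    h.g_tail, h.g_sq]

theorem g_triple (h : WittRelations P M g) (i : Transverse) :
    g i * triple g = sgn i • (triple g * g i) := by
  have h10 : g (Sum.inl 1) * g (Sum.inl 0) = -(g (Sum.inl 0) * g (Sum.inl 1)) :=
    h.g_anti (by simp)
  have h20 : g (Sum.inl 2) * g (Sum.inl 0) = -(g (Sum.inl 0) * g (Sum.inl 2)) :=
    h.g_anti (by simp)
  have h21 : g (Sum.inl 2) * g (Sum.inl 1) = -(g (Sum.inl 1) * g (Sum.inl 2)) :=
    h.g_anti (by simp)
  rcases i with i | i
  · simp only [sgn, Sum.elim_inl, one_smul]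
    fin_cases i <;>
      simp [triple, mul_assoc, h10, h20, h21, anti_tail h10, anti_tail h20, anti_tail h21,
        h.g_tail, h.g_sq]
  · have hk : ∀ k, g (Sum.inr i) * g (Sum.inl k) = -(g (Sum.inl k) * g (Sum.inr i)) :=
      fun k => h.g_anti (by simp)
    simp only [sgn, Sum.elim_inr, neg_one_smul, triple, mul_assoc, hk, anti_tail (hk _), mul_neg,
      neg_neg]

theorem PMP (h : WittRelations P M g) : P * (M * P) = (2 : ℝ) • P := by
  rw [h.MP, mul_sub, ← mul_assoc, h.PP, zero_mul, sub_zero, mul_two, two_smul]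

theorem PMP_tail (h : WittRelations P M g) (x : A) : P * (M * (P * x)) = (2 : ℝ) • (P * x) := by
  rw [← mul_assoc M, ← mul_assoc P, h.PMP, smul_mul_assoc]

theorem P_tail (h : WittRelations P M g) (x : A) : P * (P * x) = 0 := by
  rw [← mul_assoc, h.PP, zero_mul]

theorem triple_tail (h : WittRelations P M g) (x : A) : triple g * (triple g * x) = -x := by
  rw [← mul_assoc, h.triple_sq, neg_one_mul]

theorem g_triple_tail (h : WittRelations P M g) (i : Transverse) (x : A) :
    g i * (triple g * x) = sgn i • (triple g * (g i * x)) := by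
  rw [← mul_assoc, h.g_triple, smul_mul_assoc, mul_assoc]

theorem imE_mul (h : WittRelations P M g) (i j : Transverse) : imE μ P g i * imE μ P g j = 0 := by
  simp only [imE, smul_mul_assoc, mul_smul_comm, mul_assoc, h.Pg, anti_tail (h.Pg _),
    anti_tail h.P_triple, mul_neg, h.PP, mul_zero, neg_zero, smul_zero]

theorem imE_mul_imEStar (h : WittRelations P M g) (i j : Transverse) :
    imE μ P g i * imEStar μ P g j = 0 := by
  simp only [imE, imEStar, smul_mul_assoc, mul_smul_comm, mul_assoc, anti_tail (h.Pg _),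
    mul_neg, h.PP, mul_zero, neg_zero, smul_zero]

theorem imEStar_mul_imE (h : WittRelations P M g) (i j : Transverse) :
    imEStar μ P g i * imE μ P g j = 0 := by
  simp only [imE, imEStar, smul_mul_assoc, mul_smul_comm, mul_assoc, anti_tail (h.Pg _),
    anti_tail h.P_triple, mul_neg, h.PP, mul_zero, neg_zero, smul_zero]

theorem imEStar_mul (h : WittRelations P M g) (i j : Transverse) :
    imEStar μ P g i * imEStar μ P g j = 0 := by
  simp only [imEStar, smul_mul_assoc, mul_smul_comm, mul_assoc, anti_tail (h.Pg _),
    mul_neg, h.PP, mul_zero, neg_zero, smul_zero]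

theorem lie_imE (h : WittRelations P M g) (i : Transverse) :
    imMinus μ P M g * imE μ P g i - imE μ P g i * imMinus μ P M g = imEStar μ P g i := by
  simp only [imMinus, imE, imEStar, sub_mul, mul_sub, smul_mul_assoc, mul_smul_comm, mul_assoc,
    h.Pg, h.Mg, anti_tail (h.Pg _), anti_tail (h.Mg _), anti_tail h.P_triple, anti_tail h.M_triple,
    mul_neg, neg_neg, h.PP, h.P_tail, h.PMP, h.PMP_tail, h.triple_tail, h.g_triple_tail, mul_zero,
    neg_zero, smul_zero, sub_zero, zero_sub, smul_neg, smul_smul]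
  rcases i with i | i <;> simp only [sgn, freq, Sum.elim_inl, Sum.elim_inr] <;> module

theorem lie_imEStar (h : WittRelations P M g) (i : Transverse) :
    imMinus μ P M g * imEStar μ P g i - imEStar μ P g i * imMinus μ P M g
      = (-(freq μ i ^ 2)) • imE μ P g i := by
  simp only [imMinus, imE, imEStar, sub_mul, mul_sub, smul_mul_assoc, mul_smul_comm, mul_assoc,
    h.Pg, h.Mg, anti_tail (h.Pg _), anti_tail (h.Mg _), anti_tail h.P_triple, anti_tail h.M_triple,
    mul_neg, neg_neg, h.PP, h.P_tail, h.PMP, h.PMP_tail, h.triple_tail, h.g_triple_tail, mul_zero,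
    neg_zero, smul_zero, sub_zero, zero_sub, smul_neg, smul_smul]
  rcases i with i | i <;> simp only [sgn, freq, Sum.elim_inl, Sum.elim_inr] <;> module

/-- An element anticommuting with all `gᵢ` commutes with the quadratic elements. -/
theorem quad_comm_of_anti {c : A} (hc : ∀ i, c * g i = -(g i * c))
    (X : Matrix Transverse Transverse ℝ) :
    quad (fun _ => 1) g X * c = c * quad (fun _ => 1) g X := by
  simp only [quad, smul_mul_assoc, mul_smul_comm, Finset.sum_mul, Finset.mul_sum, mul_assoc,
    hc, anti_tail (hc _), mul_neg, neg_neg]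

theorem quad_lie_g (h : WittRelations P M g) (X : Rotations) (i : Transverse) :
    quad (fun _ => 1) g (blockMatrix X) * g i
      = g i * quad (fun _ => 1) g (blockMatrix X) + ∑ a, blockMatrix X a i • g a := by
  rw [← quad_lie_gen (η := fun _ => 1) (g := g) (fun _ => by norm_num) h.gg
    (X := blockMatrix X) (fun i j => by simpa using blockMatrix_skew X i j) i]
  abel

theorem quad_triple (h : WittRelations P M g) (X : Rotations) :
    quad (fun _ => 1) g (blockMatrix X) * triple g
      = triple g * quad (fun _ => 1) g (blockMatrix X) := by
  have h10 : g (Sum.inl 1) * g (Sum.inl 0) = -(g (Sum.inl 0) * g (Sum.inl 1)) :=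
    h.g_anti (by simp)
  have h20 : g (Sum.inl 2) * g (Sum.inl 0) = -(g (Sum.inl 0) * g (Sum.inl 2)) :=
    h.g_anti (by simp)
  have h21 : g (Sum.inl 2) * g (Sum.inl 1) = -(g (Sum.inl 1) * g (Sum.inl 2)) :=
    h.g_anti (by simp)
  have hd : ∀ i, blockMatrix X i i = 0 := fun i => by
    have := blockMatrix_skew X i i; linarith
  have k10 := blockMatrix_skew X (Sum.inl 0) (Sum.inl 1)
  have k20 := blockMatrix_skew X (Sum.inl 0) (Sum.inl 2)
  have k21 := blockMatrix_skew X (Sum.inl 1) (Sum.inl 2)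
  have hz : ∀ (i : Fin 6) (j : Fin 3), blockMatrix X (Sum.inr i) (Sum.inl j) = 0 := fun i j => by
    simp [blockMatrix]
  have q : ∀ j : Fin 3, quad (fun _ => 1) g (blockMatrix X) * g (Sum.inl j)
      = g (Sum.inl j) * quad (fun _ => 1) g (blockMatrix X)
        + ∑ a : Fin 3, blockMatrix X (Sum.inl a) (Sum.inl j) • g (Sum.inl a) := fun j => by
    rw [h.quad_lie_g, Fintype.sum_sum_type]
    simp [hz]
  simp only [Fin.sum_univ_three, triple] at q ⊢
  generalize quad (fun _ => 1) g (blockMatrix X) = Q at q ⊢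
  have q_tail : ∀ (j : Fin 3) (x : A), Q * (g (Sum.inl j) * x)
      = g (Sum.inl j) * (Q * x)
        + (blockMatrix X (Sum.inl 0) (Sum.inl j) • g (Sum.inl 0)
          + blockMatrix X (Sum.inl 1) (Sum.inl j) • g (Sum.inl 1)
          + blockMatrix X (Sum.inl 2) (Sum.inl j) • g (Sum.inl 2)) * x := fun j x => by
    rw [← mul_assoc, q, add_mul, mul_assoc]
  simp only [mul_assoc, q, q_tail, mul_add, add_mul, hd, k10, k20, k21, zero_smul, smul_mul_assoc,
    mul_smul_comm, neg_smul, h10, h20, h21, anti_tail h10, anti_tail h20, anti_tail h21, h.g_tail,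
    h.g_sq, mul_neg, neg_mul, mul_one, mul_zero, zero_mul, neg_neg]
  module

theorem quad_minus (h : WittRelations P M g) (X : Rotations) :
    quad (fun _ => 1) g (blockMatrix X) * imMinus μ P M g
      = imMinus μ P M g * quad (fun _ => 1) g (blockMatrix X) := by
  have hP := quad_comm_of_anti h.Pg (blockMatrix X)
  have hM := quad_comm_of_anti h.Mg (blockMatrix X)
  have hI := h.quad_triple X
  generalize quad (fun _ => 1) g (blockMatrix X) = q at *
  have e1 : q * (triple g * (P * M)) = triple g * (P * M) * q := by
    rw [← mul_assoc, hI, mul_assoc, ← mul_assoc q, hP, mul_assoc P, hM]; simp only [mul_assoc]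
  have e2 : q * (triple g * (M * P)) = triple g * (M * P) * q := by
    rw [← mul_assoc, hI, mul_assoc, ← mul_assoc q, hM, mul_assoc M, hP]; simp only [mul_assoc]
  simp only [imMinus, mul_sub, sub_mul, mul_smul_comm, smul_mul_assoc, e1, e2]

theorem quad_imE (h : WittRelations P M g) (X : Rotations) (i : Transverse) :
    quad (fun _ => 1) g (blockMatrix X) * imE μ P g i
        - imE μ P g i * quad (fun _ => 1) g (blockMatrix X)
      = ∑ a, blockMatrix X a i • imE μ P g a := by
  have hP := quad_comm_of_anti h.Pg (blockMatrix X)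
  have hI := h.quad_triple X
  have hg := h.quad_lie_g X i
  generalize quad (fun _ => 1) g (blockMatrix X) = q at *
  have e : q * (triple g * g i * P) - triple g * g i * P * q
      = ∑ a, blockMatrix X a i • (triple g * g a * P) := by
    have : q * (triple g * g i * P) = triple g * (q * g i) * P := by
      rw [← mul_assoc, ← mul_assoc, hI, mul_assoc (triple g)]
    rw [this, hg, mul_assoc _ P q, ← hP]
    simp only [mul_add, add_mul, Finset.mul_sum, Finset.sum_mul, mul_smul_comm, smul_mul_assoc,
      mul_assoc]
    abel
  simp only [imE, mul_smul_comm, smul_mul_assoc, ← smul_sub, e, Finset.smul_sum, smul_smul]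
  refine Finset.sum_congr rfl fun a _ => ?_
  congr 1
  linear_combination (-(1 / 2) : ℝ) * blockMatrix_freq μ X a i

theorem quad_imEStar (h : WittRelations P M g) (X : Rotations) (i : Transverse) :
    quad (fun _ => 1) g (blockMatrix X) * imEStar μ P g i
        - imEStar μ P g i * quad (fun _ => 1) g (blockMatrix X)
      = ∑ a, blockMatrix X a i • imEStar μ P g a := by
  have hP := quad_comm_of_anti h.Pg (blockMatrix X)
  have hg := h.quad_lie_g X i
  generalize quad (fun _ => 1) g (blockMatrix X) = q at *
  have e : q * (g i * P) - g i * P * q = ∑ a, blockMatrix X a i • (g a * P) := by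
    rw [← mul_assoc, hg, mul_assoc _ P q, ← hP]
    simp only [add_mul, Finset.sum_mul, smul_mul_assoc, mul_assoc]
    abel
  simp only [imEStar, mul_smul_comm, smul_mul_assoc, ← smul_sub, e, Finset.smul_sum, smul_smul]
  refine Finset.sum_congr rfl fun a _ => ?_
  congr 1
  linear_combination (-(1 / 2) : ℝ) * (freq μ i + freq μ a) * blockMatrix_freq μ X a i

end WittRelations

/-- The image of `∑ xᵢ eᵢ + ∑ yᵢ eᵢ*`. -/
def imNil (μ : ℝ) (P : A) (g : Transverse → A) (x y : Transverse → ℝ) : A :=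
  ∑ i, x i • imE μ P g i + ∑ i, y i • imEStar μ P g i

/-- The image of `Z + X` with `Z` in the transvection algebra and `X` in `𝔰𝔬(3) ⊕ 𝔰𝔬(6)`. -/
def imWave (μ : ℝ) (P M : A) (g : Transverse → A) (Z : CahenWallach μ) (X : Rotations) : A :=
  imNil μ P g Z.e Z.eStar + Z.minus • imMinus μ P M g + quad (fun _ => 1) g (blockMatrix X)

namespace WittRelations

variable (μ : ℝ)

theorem imNil_mul (h : WittRelations P M g) (x y x₁ y₁ : Transverse → ℝ) :
    imNil μ P g x y * imNil μ P g x₁ y₁ = 0 := by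
  simp only [imNil, add_mul, mul_add, Finset.sum_mul, Finset.mul_sum, smul_mul_assoc,
    mul_smul_comm, h.imE_mul, h.imE_mul_imEStar, h.imEStar_mul_imE, h.imEStar_mul, smul_zero,
    Finset.sum_const_zero, add_zero]

theorem lie_imNil (h : WittRelations P M g) (x y : Transverse → ℝ) :
    imMinus μ P M g * imNil μ P g x y - imNil μ P g x y * imMinus μ P M g
      = imNil μ P g (fun i => -(freq μ i ^ 2) * y i) x := by
  have : imMinus μ P M g * imNil μ P g x y - imNil μ P g x y * imMinus μ P M g
      = ∑ i, x i • (imMinus μ P M g * imE μ P g i - imE μ P g i * imMinus μ P M g)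
        + ∑ i, y i • (imMinus μ P M g * imEStar μ P g i - imEStar μ P g i * imMinus μ P M g) := by
    simp only [imNil, mul_add, add_mul, Finset.mul_sum, Finset.sum_mul, mul_smul_comm,
      smul_mul_assoc, smul_sub, Finset.sum_sub_distrib]
    abel
  rw [this]
  simp only [h.lie_imE, h.lie_imEStar, smul_smul, imNil]
  rw [add_comm]
  simp only [mul_comm]

theorem quad_imNil (h : WittRelations P M g) (X : Rotations) (x y : Transverse → ℝ) :
    quad (fun _ => 1) g (blockMatrix X) * imNil μ P g x y
        - imNil μ P g x y * quad (fun _ => 1) g (blockMatrix X)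
      = imNil μ P g ((blockMatrix X).mulVec x) ((blockMatrix X).mulVec y) := by
  have hE := h.quad_imE μ X
  have hS := h.quad_imEStar μ X
  generalize quad (fun _ => 1) g (blockMatrix X) = q at *
  have : q * imNil μ P g x y - imNil μ P g x y * q
      = ∑ i, x i • (q * imE μ P g i - imE μ P g i * q)
        + ∑ i, y i • (q * imEStar μ P g i - imEStar μ P g i * q) := by
    simp only [imNil, mul_add, add_mul, Finset.mul_sum, Finset.sum_mul, mul_smul_comm,
      smul_mul_assoc, smul_sub, Finset.sum_sub_distrib]
    abel
  rw [this]
  simp only [hE, hS, imNil, Finset.smul_sum, smul_smul, Matrix.mulVec, dotProduct, Finset.sum_smul]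
  congr 1 <;>
  · rw [Finset.sum_comm]
    simp only [mul_comm]

theorem imWave_lie (h : WittRelations P M g) (Z Z₁ : CahenWallach μ) (X X₁ : Rotations) :
    imWave μ P M g (⁅Z, Z₁⁆ + rotate μ X Z₁ - rotate μ X₁ Z) ⁅X, X₁⁆
      = imWave μ P M g Z X * imWave μ P M g Z₁ X₁ - imWave μ P M g Z₁ X₁ * imWave μ P M g Z X := by
  have a1 := h.imNil_mul μ Z.e Z.eStar Z₁.e Z₁.eStar
  have a2 := h.imNil_mul μ Z₁.e Z₁.eStar Z.e Z.eStar
  have a3 := h.lie_imNil μ Z.e Z.eStar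
  have a4 := h.lie_imNil μ Z₁.e Z₁.eStar
  have a5 := h.quad_imNil μ X Z₁.e Z₁.eStar
  have a6 := h.quad_imNil μ X₁ Z.e Z.eStar
  have a7 := h.quad_minus μ X
  have a8 := h.quad_minus μ X₁
  have a9 := quad_lie (η := fun _ => 1) (g := g) (fun _ => by norm_num) h.gg
    (X := blockMatrix X) (Y := blockMatrix X₁) (fun i j => by simpa using blockMatrix_skew X i j)
  have b : imNil μ P g (⁅Z, Z₁⁆ + rotate μ X Z₁ - rotate μ X₁ Z).e
        (⁅Z, Z₁⁆ + rotate μ X Z₁ - rotate μ X₁ Z).eStar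
      = Z.minus • imNil μ P g (fun i => -(freq μ i ^ 2) * Z₁.eStar i) Z₁.e
        - Z₁.minus • imNil μ P g (fun i => -(freq μ i ^ 2) * Z.eStar i) Z.e
        + imNil μ P g ((blockMatrix X).mulVec Z₁.e) ((blockMatrix X).mulVec Z₁.eStar)
        - imNil μ P g ((blockMatrix X₁).mulVec Z.e) ((blockMatrix X₁).mulVec Z.eStar) := by
    have r : ∀ (X : Rotations) (Z : CahenWallach μ), rotate μ X Z
      = ⟨0, 0, (blockMatrix X).mulVec Z.e, (blockMatrix X).mulVec Z.eStar⟩ := fun _ _ => rfl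
    simp only [imNil, CahenWallach.e_sub, CahenWallach.e_add, CahenWallach.eStar_sub,
      CahenWallach.eStar_add, r, Pi.sub_apply, Pi.add_apply, CahenWallach.lie_e,
      CahenWallach.lie_eStar, Finset.smul_sum, smul_add, smul_smul]
    simp only [sub_smul, add_smul, mul_sub, Finset.sum_add_distrib, Finset.sum_sub_distrib]
    have c1 : ∀ (a b c : ℝ), a * (b * c) = b * (a * c) := fun a b c => by ring
    simp only [c1 Z.minus, c1 Z₁.minus]
    abel
  have m : (⁅Z, Z₁⁆ + rotate μ X Z₁ - rotate μ X₁ Z).minus = 0 := by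
    change (0 : ℝ) + 0 - 0 = 0
    norm_num
  rw [imWave, b, m, zero_smul, blockMatrix_lie, a9, ← a3, ← a4, ← a5, ← a6, imWave, imWave]
  generalize imNil μ P g Z.e Z.eStar = N at *
  generalize imNil μ P g Z₁.e Z₁.eStar = N₁ at *
  generalize imMinus μ P M g = E at *
  generalize quad (fun _ => 1) g (blockMatrix X) = q at *
  generalize quad (fun _ => 1) g (blockMatrix X₁) = q₁ at *
  simp only [add_mul, mul_add, smul_mul_assoc, mul_smul_comm, a1, a2, a7, a8, smul_sub, smul_add, smul_smul,
    mul_comm Z₁.minus Z.minus]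
  abel

end WittRelations

end WaveRelations

theorem wittRelations : WittRelations gammaPlus gammaMinus gamma where
  PP := by
    have : wittForm (1, 0, 0) = 0 := by simp [wittForm_apply]
    rw [gammaPlus, CliffordAlgebra.ι_sq_scalar, this, map_zero]
  MM := by
    have : wittForm (0, 1, 0) = 0 := by simp [wittForm_apply]
    rw [gammaMinus, CliffordAlgebra.ι_sq_scalar, this, map_zero]
  MP := by
    have : QuadraticMap.polar wittForm (0, 1, 0) (1, 0, 0) = 2 := by
      simp [wittForm_apply, QuadraticMap.polar]
    rw [eq_sub_iff_add_eq, gammaPlus, gammaMinus, CliffordAlgebra.ι_mul_ι_add_swap, this]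
    exact map_ofNat _ 2
  Pg i := by
    have : QuadraticMap.polar wittForm (1, 0, 0) (0, 0, Pi.single i 1) = 0 := by
      simp [wittForm_apply, QuadraticMap.polar]
    rw [eq_neg_iff_add_eq_zero, gammaPlus, gamma, CliffordAlgebra.ι_mul_ι_add_swap, this, map_zero]
  Mg i := by
    have : QuadraticMap.polar wittForm (0, 1, 0) (0, 0, Pi.single i 1) = 0 := by
      simp [wittForm_apply, QuadraticMap.polar]
    rw [eq_neg_iff_add_eq_zero, gammaMinus, gamma, CliffordAlgebra.ι_mul_ι_add_swap, this, map_zero]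
  gg i j := by
    have hp : QuadraticMap.polar wittForm (0, 0, Pi.single i 1) (0, 0, Pi.single j 1)
        = if i = j then (2 * 1 : ℝ) else 0 := by
      simp only [QuadraticMap.polar, wittForm_apply, Prod.mk_add_mk]
      simp only [add_zero, mul_zero, zero_add, ← Finset.sum_sub_distrib]
      rw [Finset.sum_eq_single i]
      · by_cases hij : i = j
        · subst hij; simp; norm_num
        · simp [hij]
      · intro b _ hb
        simp [Pi.single_apply, hb]
      · simp
    rw [gamma, gamma, CliffordAlgebra.ι_mul_ι_add_swap, hp, Algebra.algebraMap_eq_smul_one]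
    split_ifs <;> simp

/-- The action of the symmetry Lie algebra of the wave on spinors, with values in the Clifford
algebra:
`e₊ ↦ 0`, `e₋ ↦ -(μ/4) I Π₊ - (μ/12) I Π₋`, `eᵢ ↦ -½ λᵢ I Γᵢ Γ₊`, `eᵢ* ↦ -½ λᵢ² Γᵢ Γ₊` and
`M_ij ↦ ½ Γᵢ Γⱼ`, where `I = Γ₁ Γ₂ Γ₃` and `Π± = ½ Γ± Γ∓`. -/
def waveSpin (μ : ℝ) : WaveAlgebra μ →ₗ⁅ℝ⁆ WaveCl where
  toFun X := imWave μ gammaPlus gammaMinus gamma X.left X.right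
  map_add' X Y := by
    change imWave μ _ _ _ (X.left + Y.left) (X.right + Y.right) = _
    simp only [imWave, imNil, CahenWallach.e_add, CahenWallach.eStar_add, CahenWallach.minus_add,
      blockMatrix_add, quad_add, add_smul, Pi.add_apply, Finset.sum_add_distrib]
    abel
  map_smul' c X := by
    change imWave μ _ _ _ (c • X.left) (c • X.right) = _
    simp only [imWave, imNil, CahenWallach.e_smul, CahenWallach.eStar_smul,
      CahenWallach.minus_smul, blockMatrix_smul, quad_smul, mul_smul, Pi.smul_apply, smul_eq_mul,
      smul_add, Finset.smul_sum, RingHom.id_apply]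
  map_lie' {X Y} := wittRelations.imWave_lie μ X.left Y.left X.right Y.right

/-- The symmetry Lie algebra of the wave acting on a module `K` of the Clifford algebra. In real
dimension `32` there are two such modules, which differ by the sign of the action of the volume
element (a choice of orientation). -/
def waveRep {K : Type*} [AddCommGroup K] [Module ℝ K] (μ : ℝ)
    (ρ : WaveCl →ₐ[ℝ] Module.End ℝ K) : WaveAlgebra μ →ₗ⁅ℝ⁆ Module.End ℝ K :=
  (ρ : WaveCl →ₗ⁅ℝ⁆ Module.End ℝ K).comp (waveSpin μ)

/-! ### The spinor modules exist

A `32`-dimensional real space carries each of the module structures used above, so statements about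
all such modules are not vacuous. The modules are given by real products of Pauli matrices. -/

section Existence

/-- A linear combination of Clifford generators squares to the quadratic form. -/
theorem sum_gen_sq {ι A : Type*} [Fintype ι] [DecidableEq ι] [Ring A] [Algebra ℝ A] {c : ι → ℝ}
    {J : ι → A} (hJ : ∀ i j, J i * J j + J j * J i = if i = j then (2 * c i) • (1 : A) else 0)
    (v : ι → ℝ) :
    (∑ i, v i • J i) * (∑ i, v i • J i) = (∑ i, c i * (v i * v i)) • (1 : A) := by
  have h : (2 : ℝ) • ((∑ i, v i • J i) * (∑ i, v i • J i))
      = (2 : ℝ) • (∑ i, c i * (v i * v i)) • (1 : A) := by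
    have e : (∑ i, v i • J i) * (∑ i, v i • J i) = ∑ i, ∑ j, (v i * v j) • (J i * J j) := by
      simp only [Finset.sum_mul, Finset.mul_sum, smul_mul_assoc, mul_smul_comm, smul_smul,
        Finset.smul_sum]
      rw [Finset.sum_comm]
      refine Finset.sum_congr rfl fun i _ => Finset.sum_congr rfl fun j _ => by rw [mul_comm (v i)]
    have e2 : ∑ i, ∑ j, (v i * v j) • (J i * J j) = ∑ i, ∑ j, (v i * v j) • (J j * J i) := by
      rw [Finset.sum_comm]
      refine Finset.sum_congr rfl fun i _ => Finset.sum_congr rfl fun j _ => by rw [mul_comm]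
    rw [e, two_smul]
    nth_rewrite 2 [e2]
    simp only [← Finset.sum_add_distrib, ← smul_add, hJ, smul_ite, smul_zero, Finset.sum_ite_eq,
      Finset.mem_univ, if_true, Finset.sum_smul, Finset.smul_sum, smul_smul]
    refine Finset.sum_congr rfl fun i _ => ?_
    congr 1; ring
  exact smul_right_injective A (two_ne_zero (α := ℝ)) h

/-- From `m` anticommuting `Jᵢ` with `Jᵢ² = -ηᵢ`, an action of the even Clifford algebra of
`x₀² + ∑ ηᵢ xᵢ²`, with `e₀ eᵢ ↦ Jᵢ`. -/
def evenAction {m : ℕ} {A : Type*} [Ring A] [Algebra ℝ A] (η : Fin (m + 1) → ℝ) (h0 : η 0 = 1)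
    (J : Fin m → A)
    (hJ : ∀ i j, J i * J j + J j * J i = if i = j then (2 * -η i.succ) • (1 : A) else 0) :
    CliffordAlgebra.even (QuadraticMap.weightedSumSquares ℝ η) →ₐ[ℝ] A :=
  let L : (Fin (m + 1) → ℝ) →ₗ[ℝ] A := ∑ i, (LinearMap.proj i.succ).smulRight (J i)
  let u : (Fin (m + 1) → ℝ) →ₗ[ℝ] A := (LinearMap.proj 0).smulRight 1
  have hL : ∀ v, L v = ∑ i, v i.succ • J i := fun v => by simp [L]
  have hu : ∀ v, u v = v 0 • (1 : A) := fun v => by simp [u]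
  have key : ∀ v, L v * L v = -(∑ i : Fin m, η i.succ * (v i.succ * v i.succ)) • (1 : A) :=
    fun v => by
      rw [hL, sum_gen_sq hJ (fun i => v i.succ)]
      simp
  have hQ : ∀ v, QuadraticMap.weightedSumSquares ℝ η v
      = v 0 * v 0 + ∑ i : Fin m, η i.succ * (v i.succ * v i.succ) := fun v => by
    rw [QuadraticMap.weightedSumSquares_apply, Fin.sum_univ_succ]
    simp [h0]
  have h1 : ∀ v, (u v - L v) * (u v + L v) = QuadraticMap.weightedSumSquares ℝ η v • (1 : A) :=
    fun v => by
      have : (u v - L v) * (u v + L v) = u v * u v - L v * L v := by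
        rw [hu]; simp only [sub_mul, mul_add, smul_mul_assoc, mul_smul_comm, one_mul, mul_one]; module
      rw [this, key, hu, hQ, smul_mul_smul_comm, one_mul, neg_smul, sub_neg_eq_add, add_smul]
  have h2 : ∀ v, (u v + L v) * (u v - L v) = QuadraticMap.weightedSumSquares ℝ η v • (1 : A) :=
    fun v => by
      rw [← h1, hu]
      simp only [sub_mul, mul_sub, add_mul, mul_add, smul_mul_assoc, mul_smul_comm, one_mul,
        mul_one]
      module
  CliffordAlgebra.even.lift (QuadraticMap.weightedSumSquares ℝ η)
    { bilin := (LinearMap.mul ℝ A).compl₁₂ (u - L) (u + L)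
      contract := fun v => by
        rw [Algebra.algebraMap_eq_smul_one, ← h1]; rfl
      contract_mid := fun a b c => by
        change (u a - L a) * (u b + L b) * ((u b - L b) * (u c + L c))
          = _ • ((u a - L a) * (u c + L c))
        rw [mul_assoc, ← mul_assoc (u b + L b), h2, smul_mul_assoc, one_mul, mul_smul_comm] }

theorem evenAction_ee {m : ℕ} {A : Type*} [Ring A] [Algebra ℝ A] (η : Fin (m + 1) → ℝ)
    (h0 : η 0 = 1) (J : Fin m → A)
    (hJ : ∀ i j, J i * J j + J j * J i = if i = j then (2 * -η i.succ) • (1 : A) else 0)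
    (v w : Fin (m + 1) → ℝ) :
    evenAction η h0 J hJ
        ((CliffordAlgebra.even.ι (QuadraticMap.weightedSumSquares ℝ η)).bilin v w)
      = (v 0 • 1 - ∑ i, v i.succ • J i) * (w 0 • 1 + ∑ i, w i.succ • J i) := by
  rw [evenAction, CliffordAlgebra.even.lift_ι]
  simp only [LinearMap.compl₁₂_apply, LinearMap.mul_apply', LinearMap.sub_apply,
    LinearMap.add_apply, LinearMap.sum_apply, LinearMap.smulRight_apply, LinearMap.proj_apply]

theorem evenAction_zero {m : ℕ} {A : Type*} [Ring A] [Algebra ℝ A] (η : Fin (m + 1) → ℝ)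
    (h0 : η 0 = 1) (J : Fin m → A)
    (hJ : ∀ i j, J i * J j + J j * J i = if i = j then (2 * -η i.succ) • (1 : A) else 0)
    (i : Fin m) :
    evenAction η h0 J hJ ((CliffordAlgebra.even.ι (QuadraticMap.weightedSumSquares ℝ η)).bilin
      (basisVec 0) (basisVec i.succ)) = J i := by
  rw [evenAction_ee]
  simp [Pi.single_apply, Fin.succ_ne_zero]

theorem evenAction_succ {m : ℕ} {A : Type*} [Ring A] [Algebra ℝ A] (η : Fin (m + 1) → ℝ)
    (h0 : η 0 = 1) (J : Fin m → A)
    (hJ : ∀ i j, J i * J j + J j * J i = if i = j then (2 * -η i.succ) • (1 : A) else 0)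
    (i j : Fin m) :
    evenAction η h0 J hJ ((CliffordAlgebra.even.ι (QuadraticMap.weightedSumSquares ℝ η)).bilin
      (basisVec i.succ) (basisVec j.succ)) = -(J i * J j) := by
  rw [evenAction_ee]
  simp [Pi.single_apply, (Fin.succ_ne_zero _).symm]

theorem evenAction_commute {m : ℕ} {A : Type*} [Ring A] [Algebra ℝ A] (η : Fin (m + 1) → ℝ)
    (h0 : η 0 = 1) (J : Fin m → A)
    (hJ : ∀ i j, J i * J j + J j * J i = if i = j then (2 * -η i.succ) • (1 : A) else 0)
    (c : A) (hc : ∀ i, Commute c (J i))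
    (x : CliffordAlgebra.even (QuadraticMap.weightedSumSquares ℝ η)) :
    Commute c (evenAction η h0 J hJ x) := by
  obtain ⟨x, hx⟩ := x
  induction x, hx using CliffordAlgebra.even_induction with
  | algebraMap r =>
    have : (⟨algebraMap ℝ _ r, SetLike.algebraMap_mem_graded _ r⟩ :
        CliffordAlgebra.even (QuadraticMap.weightedSumSquares ℝ η)) = algebraMap ℝ _ r := rfl
    rw [this, AlgHom.commutes]
    exact (Algebra.commutes r c).symm
  | add x y hx hy ihx ihy =>
    have := ihx.add_right ihy
    rw [← map_add] at this
    exact this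
  | ι_mul_ι_mul v w x hx ih =>
    have h1 : Commute c (evenAction η h0 J hJ
        ((CliffordAlgebra.even.ι (QuadraticMap.weightedSumSquares ℝ η)).bilin v w)) := by
      rw [evenAction_ee]
      have hs : ∀ u : Fin (m + 1) → ℝ, Commute c (∑ i, u i.succ • J i) := fun u =>
        Commute.sum_right _ _ _ fun i _ => (hc i).smul_right _
      have h1 : ∀ r : ℝ, Commute c (r • (1 : A)) := fun r => (Commute.one_right c).smul_right r
      exact ((h1 _).sub_right (hs v)).mul_right ((h1 _).add_right (hs w))
    have := h1.mul_right ih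
    rw [← map_mul] at this
    exact this

/-- Labels of a basis of a `32`-dimensional space. -/
abbrev Bits : Type := Fin 5 → ZMod 2

theorem finrank_bits : Module.finrank ℝ (Bits → ℝ) = 32 := by
  simp [Module.finrank_fintype_fun_eq_card, ZMod.card]

/-- The nontrivial character of `ℤ/2`. -/
def chi (a : ZMod 2) : ℤ := if a = 0 then 1 else -1

theorem chi_add : ∀ a b : ZMod 2, chi (a + b) = chi a * chi b := by decide

/-- Products of Pauli matrices: `f ↦ f(· + x)` followed by multiplication by `χ(z ⬝ ·)`. -/
def pauli (T : Bits × Bits) : Module.End ℝ (Bits → ℝ) where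
  toFun f b := (chi (T.2 ⬝ᵥ b) : ℝ) * f (b + T.1)
  map_add' f g := by ext b; simp [mul_add]
  map_smul' c f := by ext b; simp [mul_left_comm]

theorem pauli_mul (T U : Bits × Bits) :
    pauli T * pauli U = (chi (U.2 ⬝ᵥ T.1) : ℝ) • pauli (T + U) := by
  refine LinearMap.ext fun f => funext fun b => ?_
  change (chi (T.2 ⬝ᵥ b) : ℝ) * ((chi (U.2 ⬝ᵥ (b + T.1)) : ℝ) * f (b + T.1 + U.1))
    = (chi (U.2 ⬝ᵥ T.1) : ℝ) * ((chi ((T.2 + U.2) ⬝ᵥ b) : ℝ) * f (b + (T.1 + U.1)))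
  rw [add_dotProduct, dotProduct_add, chi_add, chi_add, add_assoc]
  push_cast
  ring

theorem pauli_double (T : Bits × Bits) : pauli (T + T) = 1 := by
  have h : T + T = 0 := by
    have : ∀ a : ZMod 2, a + a = 0 := by decide
    ext i <;> exact this _
  rw [h]
  refine LinearMap.ext fun f => funext fun b => ?_
  change (chi (0 ⬝ᵥ b) : ℝ) * f (b + 0) = f b
  simp [chi]

theorem pauli_rel {n : ℕ} (T : Fin n → Bits × Bits) (s : Fin n → ℤ)
    (h : ∀ i j, chi ((T j).2 ⬝ᵥ (T i).1) + chi ((T i).2 ⬝ᵥ (T j).1) = if i = j then 2 * s i else 0)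
    (i j : Fin n) :
    pauli (T i) * pauli (T j) + pauli (T j) * pauli (T i)
      = if i = j then (2 * (s i : ℝ)) • (1 : Module.End ℝ (Bits → ℝ)) else 0 := by
  rw [pauli_mul, pauli_mul, add_comm (T j) (T i), ← add_smul]
  have := h i j
  have h2 : (chi ((T j).2 ⬝ᵥ (T i).1) : ℝ) + (chi ((T i).2 ⬝ᵥ (T j).1) : ℝ)
      = if i = j then 2 * (s i : ℝ) else 0 := by
    rw [← Int.cast_add, this]; split_ifs <;> simp
  rw [h2]
  split_ifs with hij
  · subst hij; rw [pauli_double]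
  · rw [zero_smul]

theorem pauli_commute {T U : Bits × Bits} (h : T.2 ⬝ᵥ U.1 = U.2 ⬝ᵥ T.1) :
    pauli T * pauli U = pauli U * pauli T := by
  rw [pauli_mul, pauli_mul, add_comm U T, h]

/-- The binary digits of two numbers. -/
def bits (x z : ℕ) : Bits × Bits :=
  (fun k => if x.testBit k then 1 else 0, fun k => if z.testBit k then 1 else 0)

/-- Generators for the `Cℓ⁰(10,1)`-module. -/
def minkT : Fin 10 → Bits × Bits :=
  ![bits 1 1, bits 2 3, bits 3 6, bits 4 7, bits 5 4, bits 6 5, bits 7 10, bits 15 2, bits 31 26,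
    bits 15 26]

set_option maxRecDepth 100000 in
theorem exists_minkowski : ∃ _ρ : EvenCl 10 1 →ₐ[ℝ] Module.End ℝ (Bits → ℝ), True := by
  have h := pauli_rel minkT (fun i => if i.1 < 9 then -1 else 1) (by decide)
  refine ⟨evenAction (signature 10 1) (by simp [signature]) (fun i => pauli (minkT i))
    fun i j => ?_, trivial⟩
  rw [h i j]
  congr 3
  fin_cases i <;> simp [signature]

/-- Generators for the action of `Cℓ⁰(3,2)`. -/
def adsFourA : Fin 4 → Bits × Bits := ![bits 25 8, bits 9 26, bits 21 22, bits 5 8]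

/-- Generators for the commuting action of `Cℓ⁰(8)`. -/
def adsFourS : Fin 7 → Bits × Bits :=
  ![bits 18 2, bits 31 1, bits 16 21, bits 1 15, bits 17 24, bits 15 27, bits 2 26]

/-- Generators for the action of `Cℓ⁰(6,2)`. -/
def adsSevenA : Fin 7 → Bits × Bits :=
  ![bits 8 27, bits 23 4, bits 16 22, bits 29 18, bits 1 21, bits 0 27, bits 19 21]

/-- Generators for the commuting action of `Cℓ⁰(5)`. -/
def adsSevenS : Fin 4 → Bits × Bits := ![bits 13 22, bits 24 23, bits 7 4, bits 17 18]

theorem neg_mul_three {A : Type*} [Ring A] [Algebra ℝ A] (a b c d : A) (x y z : ℝ) :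
    a * -(x • b) * -(y • c) * -(z • d) = -((x * y * z) • (a * b * c * d)) := by
  simp only [mul_neg, neg_mul, smul_mul_assoc, mul_smul_comm, smul_neg, neg_neg, smul_smul]
  module

theorem smul_mul_three {A : Type*} [Ring A] [Algebra ℝ A] {a b c d e f g : A} {x y z : ℝ}
    (h1 : a * b = x • e) (h2 : e * c = y • f) (h3 : f * d = z • g) :
    a * b * c * d = (x * y * z) • g := by
  rw [h1, smul_mul_assoc, h2, smul_smul, smul_mul_assoc, h3, smul_smul]

theorem pauli_seven (T : Fin 7 → Bits × Bits)
    (h0 : T 0 + (T 1 + T 2) + (T 3 + T 4) + (T 5 + T 6) = 0)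
    (h1 : chi ((T 2).2 ⬝ᵥ (T 1).1) * chi ((T 4).2 ⬝ᵥ (T 3).1) * chi ((T 6).2 ⬝ᵥ (T 5).1)
      * chi ((T 1 + T 2).2 ⬝ᵥ (T 0).1) * chi ((T 3 + T 4).2 ⬝ᵥ (T 0 + (T 1 + T 2)).1)
      * chi ((T 5 + T 6).2 ⬝ᵥ (T 0 + (T 1 + T 2) + (T 3 + T 4)).1) = 1) :
    pauli (T 0) * -(pauli (T 1) * pauli (T 2)) * -(pauli (T 3) * pauli (T 4))
      * -(pauli (T 5) * pauli (T 6)) = -1 := by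
  have h2 : pauli (0 : Bits × Bits) = 1 := by rw [← pauli_double 0, add_zero]
  have h3 := smul_mul_three (pauli_mul (T 0) (T 1 + T 2)) (pauli_mul _ (T 3 + T 4))
    (pauli_mul _ (T 5 + T 6))
  rw [pauli_mul (T 1), pauli_mul (T 3), pauli_mul (T 5)]
  refine (neg_mul_three _ _ _ _ _ _ _).trans ?_
  rw [h3, smul_smul, h0, h2]
  refine congrArg (fun t => -t) ?_
  convert one_smul ℝ (1 : Module.End ℝ (Bits → ℝ))
  rw [← Int.cast_one, ← h1]
  push_cast
  ring

set_option maxRecDepth 100000 in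
theorem exists_adsFour : ∃ ρ : EvenCl 3 2 ⊗[ℝ] EvenCl 8 0 →ₐ[ℝ] Module.End ℝ (Bits → ℝ),
    ρ (1 ⊗ₜ volume8 rfl) = -1 := by
  have hA := pauli_rel adsFourA (fun i => if i.1 < 2 then -1 else 1) (by decide)
  have hS := pauli_rel adsFourS (fun _ => -1) (by decide)
  have hAS : ∀ i j, Commute (pauli (adsFourA i)) (pauli (adsFourS j)) := by
    have : ∀ i j, (adsFourA i).2 ⬝ᵥ (adsFourS j).1 = (adsFourS j).2 ⬝ᵥ (adsFourA i).1 := by decide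
    exact fun i j => pauli_commute (this i j)
  have hA1 : ∀ i j : Fin 4, pauli (adsFourA i) * pauli (adsFourA j)
      + pauli (adsFourA j) * pauli (adsFourA i)
      = if i = j then (2 * -signature 3 2 i.succ) • (1 : Module.End ℝ (Bits → ℝ)) else 0 :=
    fun i j => by
      rw [hA]; congr 3; fin_cases i <;> simp [signature]
  have hS1 : ∀ i j : Fin 7, pauli (adsFourS i) * pauli (adsFourS j)
      + pauli (adsFourS j) * pauli (adsFourS i)
      = if i = j then (2 * -signature 8 0 i.succ) • (1 : Module.End ℝ (Bits → ℝ)) else 0 :=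
    fun i j => by
      rw [hS]; congr 3; fin_cases i <;> simp [signature]
  refine ⟨Algebra.TensorProduct.lift
    (evenAction (signature 3 2) (by simp [signature]) (fun i => pauli (adsFourA i)) hA1)
    (evenAction (signature 8 0) (by simp [signature]) (fun i => pauli (adsFourS i)) hS1)
    fun x y => evenAction_commute _ _ _ _ _ (fun j => ?_) y, ?_⟩
  · exact (evenAction_commute _ _ _ _ _ (fun i => (hAS i j).symm) x).symm
  · rw [Algebra.TensorProduct.lift_tmul, map_one, one_mul]
    refine Eq.trans ?_ (pauli_seven adsFourS (by decide) (by decide))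
    simp only [volume8, map_mul]
    congr 1
    · congr 1
      · congr 1
        · exact evenAction_zero _ _ _ hS1 0
        · exact evenAction_succ _ _ _ hS1 1 2
      · exact evenAction_succ _ _ _ hS1 3 4
    · exact evenAction_succ _ _ _ hS1 5 6

set_option maxRecDepth 100000 in
theorem exists_adsSeven : ∃ ρ : EvenCl 6 2 ⊗[ℝ] EvenCl 5 0 →ₐ[ℝ] Module.End ℝ (Bits → ℝ),
    ρ (volume8 rfl ⊗ₜ 1) = -1 := by
  have hA := pauli_rel adsSevenA (fun i => if i.1 < 5 then -1 else 1) (by decide)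
  have hS := pauli_rel adsSevenS (fun _ => -1) (by decide)
  have hAS : ∀ i j, Commute (pauli (adsSevenA i)) (pauli (adsSevenS j)) := by
    have : ∀ i j, (adsSevenA i).2 ⬝ᵥ (adsSevenS j).1 = (adsSevenS j).2 ⬝ᵥ (adsSevenA i).1 := by decide
    exact fun i j => pauli_commute (this i j)
  have hA1 : ∀ i j : Fin 7, pauli (adsSevenA i) * pauli (adsSevenA j)
      + pauli (adsSevenA j) * pauli (adsSevenA i)
      = if i = j then (2 * -signature 6 2 i.succ) • (1 : Module.End ℝ (Bits → ℝ)) else 0 :=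
    fun i j => by
      rw [hA]; congr 3; fin_cases i <;> simp [signature]
  have hS1 : ∀ i j : Fin 4, pauli (adsSevenS i) * pauli (adsSevenS j)
      + pauli (adsSevenS j) * pauli (adsSevenS i)
      = if i = j then (2 * -signature 5 0 i.succ) • (1 : Module.End ℝ (Bits → ℝ)) else 0 :=
    fun i j => by
      rw [hS]; congr 3; fin_cases i <;> simp [signature]
  refine ⟨Algebra.TensorProduct.lift
    (evenAction (signature 6 2) (by simp [signature]) (fun i => pauli (adsSevenA i)) hA1)
    (evenAction (signature 5 0) (by simp [signature]) (fun i => pauli (adsSevenS i)) hS1)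
    fun x y => evenAction_commute _ _ _ _ _ (fun j => ?_) y, ?_⟩
  · exact (evenAction_commute _ _ _ _ _ (fun i => (hAS i j).symm) x).symm
  · rw [Algebra.TensorProduct.lift_tmul, map_one, mul_one]
    refine Eq.trans ?_ (pauli_seven adsSevenA (by decide) (by decide))
    simp only [volume8, map_mul]
    congr 1
    · congr 1
      · congr 1
        · exact evenAction_zero _ _ _ hA1 0
        · exact evenAction_succ _ _ _ hA1 1 2
      · exact evenAction_succ _ _ _ hA1 3 4
    · exact evenAction_succ _ _ _ hA1 5 6

/-- Generators for the `Cℓ(10,1)`-module. -/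
def waveT : Fin 11 → Bits × Bits :=
  ![bits 0 1, bits 1 0, bits 3 3, bits 5 7, bits 7 13, bits 9 15, bits 11 9, bits 13 11,
    bits 15 21, bits 31 5, bits 31 21]

set_option maxRecDepth 100000 in
theorem exists_wave : ∃ _ρ : WaveCl →ₐ[ℝ] Module.End ℝ (Bits → ℝ), True := by
  have h := pauli_rel waveT (fun i => if i.1 < 10 then 1 else -1) (by decide)
  let L : (ℝ × ℝ × (Transverse → ℝ)) →ₗ[ℝ] (Fin 11 → ℝ) :=
    { toFun := fun v =>
        ![v.2.2 (.inl 0), v.2.2 (.inl 1), v.2.2 (.inl 2), v.2.2 (.inr 0), v.2.2 (.inr 1),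
          v.2.2 (.inr 2), v.2.2 (.inr 3), v.2.2 (.inr 4), v.2.2 (.inr 5), v.1 + v.2.1 / 2,
          v.1 - v.2.1 / 2]
      map_add' := fun v w => by ext k; fin_cases k <;> simp <;> ring
      map_smul' := fun c v => by ext k; fin_cases k <;> simp <;> ring }
  let f : (ℝ × ℝ × (Transverse → ℝ)) →ₗ[ℝ] Module.End ℝ (Bits → ℝ) :=
    ∑ k, ((LinearMap.proj k).comp L).smulRight (pauli (waveT k))
  have hf : ∀ v, f v = ∑ k, L v k • pauli (waveT k) := fun v => by simp [f]
  refine ⟨CliffordAlgebra.lift wittForm ⟨f, fun v => ?_⟩, trivial⟩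
  rw [hf, Algebra.algebraMap_eq_smul_one, sum_gen_sq h]
  congr 1
  rw [wittForm_apply]
  simp [L, Fin.sum_univ_succ]
  ring

end Existence

end MaxSusy

end

noncomputable section

namespace MaxSusy

/-! ### Conjugation by an exponential -/

section NormedAlgebra

variable {𝔸 : Type*} [NormedRing 𝔸] [NormedAlgebra ℝ 𝔸] [FiniteDimensional ℝ 𝔸]

/-! Write `A` for the endomorphism `R(X)` and `G = exp A`. Having at least 31 invariant spinors out
of 32 means `rk (G - 1) ≤ 1`, so the claim is that `G - 1` cannot have rank exactly one. Two
principles carry the proof.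

Rigidity (`eq_one_of_commute`): if `G` commutes with some `J` such that `J² = -c`, `c > 0`, then the
range of `G - 1` is stable under a complex structure. Its real dimension is even, hence zero.

Producing such a `J` (`exists_endExp_commutator_rk_le`): suppose `ad A` preserves a space `V` and
sends `B` into `V`. Exponentiating `ad A` gives `G B G⁻¹ = B + D` with `D ∈ V`, while `D = [G - 1,
B] G⁻¹` has rank at most 2. If `V` has no nonzero element of rank at most 2, then `G` commutes with
`B`.

Freund–Rubin: `V` is the image of the Clifford algebra of the sphere factor. It commutes with the
quaternionic structure generated by `e₁e₂` and `e₂e₃` in the other factor, so its nonzero elements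
have rank greater than 2. Taking `B = e₁e₂` in the sphere factor, `G` commutes with `B`, and `B² =
-1`.

Minkowski: with `ω` the volume element, the even elements `eᵢω` are Clifford generators spanning an
`𝔰𝔬(10,1)`-stable `V`. A nonzero element of `V` has a nonzero scalar anticommutator with some
generator, so it cannot have small rank. Hence `G` commutes with all generators, and a product of
two of them serves as `J`.

The wave: the same argument with `V` spanned by `Γ₊` and `IΓ₊` shows that `N = G - 1` commutes with
both. Then `NΓ₊` intertwines `I` with `-I` and has rank at most one, so `NΓ₊ = Γ₊N = 0`. The
commutator of `G` with `Γ₊Γ₋` now equals `-Γ₊Γ₋N`. It is also `D G` with `D` in the image of the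
span of the `eᵢ, eᵢ*`, so `D` has rank at most one. As `D` commutes with a complex structure made of
two vectors of `ℝ⁶`, it vanishes. Hence `Γ₊Γ₋N = 0`, and `2N = (Γ₋Γ₊ + Γ₊Γ₋)N = 0`. -/

theorem hasSum_exp_clm_apply (T : 𝔸 →L[ℝ] 𝔸) (b : 𝔸) :
    HasSum (fun k : ℕ => ((k.factorial : ℝ)⁻¹) • (T ^ k) b) (NormedSpace.exp T b) := by
  have := FiniteDimensional.complete ℝ 𝔸
  exact (NormedSpace.exp_series_hasSum_exp' (𝕂 := ℝ) T).mapL (ContinuousLinearMap.apply ℝ 𝔸 b)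

theorem exp_mul_left_apply (a b : 𝔸) :
    NormedSpace.exp (ContinuousLinearMap.mul ℝ 𝔸 a) b = NormedSpace.exp a * b := by
  have := FiniteDimensional.complete ℝ 𝔸
  refine (hasSum_exp_clm_apply _ b).unique ?_
  have h := (NormedSpace.exp_series_hasSum_exp' (𝕂 := ℝ) a).mul_right b
  have e : ∀ k : ℕ, (ContinuousLinearMap.mul ℝ 𝔸 a ^ k) b = a ^ k * b := fun k => by
    induction k with
    | zero => simp
    | succ k ih => rw [pow_succ', mul_apply_eq_comp, ih, pow_succ', mul_assoc]; rfl
  simpa only [e, smul_mul_assoc] using h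

theorem exp_mul_right_apply (a b : 𝔸) :
    NormedSpace.exp ((ContinuousLinearMap.mul ℝ 𝔸).flip a) b = b * NormedSpace.exp a := by
  have := FiniteDimensional.complete ℝ 𝔸
  refine (hasSum_exp_clm_apply _ b).unique ?_
  have h := (NormedSpace.exp_series_hasSum_exp' (𝕂 := ℝ) a).mul_left b
  have e : ∀ k : ℕ, ((ContinuousLinearMap.mul ℝ 𝔸).flip a ^ k) b = b * a ^ k := fun k => by
    induction k with
    | zero => simp
    | succ k ih => rw [pow_succ', mul_apply_eq_comp, ih, pow_succ, ← mul_assoc]; rfl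
  simpa only [e, mul_smul_comm] using h

/-- Removing the zeroth term `b` from the exponential series leaves terms in `V`; a
finite-dimensional subspace is closed, so the sum stays there. -/
theorem exp_clm_apply_sub_mem {T : 𝔸 →L[ℝ] 𝔸} {V : Submodule ℝ 𝔸} (hV : ∀ v ∈ V, T v ∈ V) {b : 𝔸}
    (hb : T b ∈ V) : NormedSpace.exp T b - b ∈ V := by
  have h := (hasSum_exp_clm_apply T b).sub (hasSum_ite_eq (0 : ℕ) b)
  refine (Submodule.closed_of_finiteDimensional V).mem_of_tendsto h
    (Filter.Eventually.of_forall fun s => V.sum_mem fun k _ => ?_)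
  rcases k with _ | k
  · simp
  · have : ∀ k : ℕ, (T ^ (k + 1)) b ∈ V := fun k => by
      induction k with
      | zero => simpa using hb
      | succ k ih => rw [pow_succ']; exact hV _ ih
    simpa using V.smul_mem _ (this k)

/-- If `ad a` preserves `V` and sends `b` into `V`, then `exp a` fixes `b` modulo `V`. -/
theorem exp_conj_sub_mem {a b : 𝔸} {V : Submodule ℝ 𝔸} (hV : ∀ v ∈ V, a * v - v * a ∈ V)
    (hb : a * b - b * a ∈ V) : NormedSpace.exp a * b * NormedSpace.exp (-a) - b ∈ V := by
  have := FiniteDimensional.complete ℝ 𝔸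
  let _ : NormedAlgebra ℚ (𝔸 →L[ℝ] 𝔸) := NormedAlgebra.restrictScalars ℚ ℝ _
  have hT : ∀ v, (ContinuousLinearMap.mul ℝ 𝔸 a + (ContinuousLinearMap.mul ℝ 𝔸).flip (-a)) v
      = a * v - v * a := fun v => by simp [sub_eq_add_neg]
  -- Associativity makes left and right multiplication commute, so `exp (ad a)` factors into left
  -- multiplication by `exp a` and right multiplication by `exp (-a)`.
  have hc : Commute ((ContinuousLinearMap.mul ℝ 𝔸).flip (-a)) (ContinuousLinearMap.mul ℝ 𝔸 a) := by
    ext v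
    change (a * v) * -a = a * (v * -a)
    rw [mul_assoc]
  have h := exp_clm_apply_sub_mem (V := V) (fun v hv => by rw [hT]; exact hV v hv)
    (b := b) (by rw [hT]; exact hb)
  rwa [add_comm, NormedSpace.exp_add_of_commute hc, mul_apply_eq_comp,
    exp_mul_left_apply, exp_mul_right_apply] at h

end NormedAlgebra

-- The norm is auxiliary: the conclusion depends only on the topology of the matrix algebra.
attribute [local instance] Matrix.linftyOpNormedRing Matrix.linftyOpNormedAlgebra in
theorem matrix_exp_conj_sub_mem {n : Type*} [Fintype n] [DecidableEq n] {a b : Matrix n n ℝ}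
    {V : Submodule ℝ (Matrix n n ℝ)} (hV : ∀ v ∈ V, a * v - v * a ∈ V)
    (hb : a * b - b * a ∈ V) : NormedSpace.exp a * b * NormedSpace.exp (-a) - b ∈ V :=
  exp_conj_sub_mem hV hb

theorem matrix_exp_neg_mul {n : Type*} [Fintype n] [DecidableEq n] (a : Matrix n n ℝ) :
    NormedSpace.exp (-a) * NormedSpace.exp a = 1 := by
  have h := Matrix.isUnit_exp a
  rw [Matrix.exp_neg]
  exact Matrix.nonsing_inv_mul _ ((Matrix.isUnit_iff_isUnit_det _).1 h)

/-- Replaces the linear equivalences in the definition of `endExp` by an algebra equivalence, so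
that products can be transported. -/
theorem toLin_exp_toMatrix {K n : Type*} [AddCommGroup K] [Module ℝ K] [Fintype n] [DecidableEq n]
    (b : Module.Basis n ℝ K) (A : Module.End ℝ K) :
    Matrix.toLin b b (NormedSpace.exp (LinearMap.toMatrix b b A))
      = (LinearMap.toMatrixAlgEquiv b).symm
        (NormedSpace.exp (LinearMap.toMatrixAlgEquiv b A)) := rfl

/-! ### Exponentials of endomorphisms. -/

section Exponential

variable {K : Type*} [AddCommGroup K] [Module ℝ K] [FiniteDimensional ℝ K]

theorem endExp_eq (A : Module.End ℝ K) :
    endExp A = (LinearMap.toMatrixAlgEquiv (Module.finBasis ℝ K)).symm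
      (NormedSpace.exp (LinearMap.toMatrixAlgEquiv (Module.finBasis ℝ K) A)) := by
  rw [endExp, toLin_exp_toMatrix]

theorem endExp_neg_mul (A : Module.End ℝ K) : endExp (-A) * endExp A = 1 := by
  rw [endExp_eq, endExp_eq, ← map_mul, map_neg, matrix_exp_neg_mul, map_one]

/-- If `ad A` preserves `V` and sends `B` into `V`, then the commutator of `exp A` with `B` lies in
`V * exp A`. -/
theorem exists_endExp_commutator {A B : Module.End ℝ K} {V : Submodule ℝ (Module.End ℝ K)}
    (hV : ∀ v ∈ V, A * v - v * A ∈ V) (hB : A * B - B * A ∈ V) :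
    ∃ D ∈ V, endExp A * B - B * endExp A = D * endExp A := by
  let e := LinearMap.toMatrixAlgEquiv (Module.finBasis ℝ K)
  have h := matrix_exp_conj_sub_mem (a := e A) (b := e B) (V := V.map e.toLinearMap)
    (fun v hv => by
      obtain ⟨w, hw, rfl⟩ := hv
      exact ⟨A * w - w * A, hV w hw, by simp⟩)
    ⟨A * B - B * A, hB, by simp⟩
  obtain ⟨D, hD, hD'⟩ := h
  have hD2 : D = endExp A * B * endExp (-A) - B := by
    apply e.injective
    refine hD'.trans ?_
    rw [endExp_eq, endExp_eq, map_sub, map_mul, map_mul]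
    simp [e]
  refine ⟨D, hD, ?_⟩
  rw [hD2, sub_mul, mul_assoc _ (endExp (-A)), endExp_neg_mul, mul_one]

end Exponential

/-! ### Endomorphisms of small rank -/

section Rank

variable {K : Type*} [AddCommGroup K] [Module ℝ K]

/-- The rank of an endomorphism. -/
def rk (f : Module.End ℝ K) : ℕ := Module.finrank ℝ (LinearMap.range f)

theorem rk_smul_le [FiniteDimensional ℝ K] (c : ℝ) (f : Module.End ℝ K) : rk (c • f) ≤ rk f := by
  refine Submodule.finrank_mono ?_
  rintro _ ⟨x, rfl⟩
  exact ⟨c • x, by simp⟩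

theorem rk_add_le [FiniteDimensional ℝ K] (f g : Module.End ℝ K) : rk (f + g) ≤ rk f + rk g :=
  (Submodule.finrank_mono (by rintro _ ⟨x, rfl⟩
                              exact Submodule.add_mem_sup ⟨x, rfl⟩ ⟨x, rfl⟩)).trans
    (Submodule.finrank_add_le_finrank_add_finrank _ _)

theorem rk_sub_le [FiniteDimensional ℝ K] (f g : Module.End ℝ K) : rk (f - g) ≤ rk f + rk g := by
  have h := rk_smul_le (-1) g
  rw [neg_one_smul] at h
  rw [sub_eq_add_neg]
  exact (rk_add_le f (-g)).trans (Nat.add_le_add_left h _)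

theorem rk_mul_le_left [FiniteDimensional ℝ K] (f g : Module.End ℝ K) : rk (f * g) ≤ rk f :=
  Submodule.finrank_mono (by rintro _ ⟨x, rfl⟩; exact ⟨g x, rfl⟩)

theorem rk_mul_le_right [FiniteDimensional ℝ K] (f g : Module.End ℝ K) : rk (f * g) ≤ rk g := by
  rw [rk, Module.End.mul_eq_comp, LinearMap.range_comp]
  exact Submodule.finrank_map_le _ _

theorem rk_smul_one [FiniteDimensional ℝ K] {c : ℝ} (hc : c ≠ 0) :
    rk (c • (1 : Module.End ℝ K)) = Module.finrank ℝ K := by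
  have : LinearMap.range (c • (1 : Module.End ℝ K)) = ⊤ :=
    LinearMap.range_eq_top.2 fun x => ⟨c⁻¹ • x, by simp [smul_smul, hc]⟩
  rw [rk, this, finrank_top]

/-- Rank–nullity: the kernel of `g - 1` is the space of invariants. -/
theorem rk_sub_one_le [FiniteDimensional ℝ K] (hK : Module.finrank ℝ K = 32) {g : Module.End ℝ K}
    (hg : 31 ≤ Module.finrank ℝ (invariants g)) : rk (g - 1) ≤ 1 := by
  have h := LinearMap.finrank_range_add_finrank_ker (g - 1)
  have : LinearMap.ker (g - 1) = invariants g := by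
    ext x
    simp [invariants, sub_eq_zero]
  rw [this] at h
  unfold rk
  omega

/-- A map of rank at most one that intertwines a complex structure is zero. -/
theorem eq_zero_of_rk_le_one [FiniteDimensional ℝ K] {J J' f : Module.End ℝ K} {c : ℝ} (hc : 0 < c)
    (hJ : J * J = -(c • 1)) (hf : J * f = f * J') (h : rk f ≤ 1) : f = 0 := by
  by_contra hne
  obtain ⟨x, hx⟩ : ∃ x, f x ≠ 0 := by
    by_contra! h0
    exact hne (LinearMap.ext h0)
  have hJx : J (f x) = f (J' x) := LinearMap.congr_fun hf x
  obtain ⟨⟨w, hw⟩, hw'⟩ := finrank_le_one_iff.1 h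
  obtain ⟨a, ha⟩ := hw' ⟨f x, x, rfl⟩
  obtain ⟨b, hb⟩ := hw' ⟨J (f x), J' x, hJx.symm⟩
  have ha : a • w = f x := congrArg Subtype.val ha
  have hb : b • w = J (f x) := congrArg Subtype.val hb
  have ha0 : a ≠ 0 := by
    rintro rfl
    exact hx (by rw [← ha, zero_smul])
  -- The range is a line stable under `J`, so `J` acts there by a real scalar, whose square would
  -- have to be `-c < 0`.
  have h1 : J (f x) = (b / a) • f x := by
    rw [← hb, ← ha, smul_smul, div_mul_cancel₀ _ ha0]
  have h2 : J (J (f x)) = -(c • f x) := LinearMap.congr_fun hJ (f x)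
  rw [h1, map_smul, h1, smul_smul, ← neg_smul] at h2
  have h3 := smul_left_injective ℝ hx h2
  nlinarith [mul_self_nonneg (b / a)]

/-- A map of rank at most two that commutes with a quaternionic structure is zero. -/
theorem eq_zero_of_rk_le_two [FiniteDimensional ℝ K] {I J f : Module.End ℝ K} (hI : I * I = -1)
    (hJ : J * J = -1) (hIJ : I * J = -(J * I)) (hIf : I * f = f * I) (hJf : J * f = f * J)
    (h : rk f ≤ 2) : f = 0 := by
  by_contra hne
  obtain ⟨x, hx⟩ : ∃ x, f x ≠ 0 := by
    by_contra! h0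
    exact hne (LinearMap.ext h0)
  -- The range is a quaternionic vector space; the three vectors `f x`, `I (f x)`, `J (f x)` already
  -- exceed the allowed rank.
  have h1 : LinearIndependent ℝ ![(⟨f x, x, rfl⟩ : LinearMap.range f),
      ⟨f (I x), I x, rfl⟩, ⟨f (J x), J x, rfl⟩] := by
    rw [Fintype.linearIndependent_iff]
    intro g hg
    have hg' : g 0 • f x + g 1 • f (I x) + g 2 • f (J x) = 0 := by
      simpa [Fin.sum_univ_three] using congrArg Subtype.val hg
    have hIx : f (I x) = I (f x) := (LinearMap.congr_fun hIf x).symm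
    have hJx : f (J x) = J (f x) := (LinearMap.congr_fun hJf x).symm
    rw [hIx, hJx] at hg'
    have hII : I (I (f x)) = -f x := LinearMap.congr_fun hI (f x)
    have hJJ : J (J (f x)) = -f x := LinearMap.congr_fun hJ (f x)
    have hIJx : I (J (f x)) = -J (I (f x)) := LinearMap.congr_fun hIJ (f x)
    -- Apply the conjugate `g 0 - g 1 I - g 2 J` to the relation; the cross terms cancel because `I`
    -- and `J` anticommute.
    have e : (g 0 * g 0 + g 1 * g 1 + g 2 * g 2) • f x = 0 := by
      have e1 := congrArg (g 0 • ·) hg'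
      have e2 := congrArg (fun v => g 1 • I v) hg'
      have e3 := congrArg (fun v => g 2 • J v) hg'
      simp only [map_add, map_smul, hII, hJJ, hIJx, map_zero, smul_zero] at e1 e2 e3
      have e4 := congrArg₂ (· - ·) (congrArg₂ (· - ·) e1 e2) e3
      simp only [sub_zero] at e4
      rw [← e4]
      module
    have e' := (smul_eq_zero.1 e).resolve_right hx
    have h0 := mul_self_nonneg (g 0)
    have h1 := mul_self_nonneg (g 1)
    have h2 := mul_self_nonneg (g 2)
    intro i
    fin_cases i <;> refine mul_self_eq_zero.1 ?_ <;> simp <;> nlinarith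
  have := h1.fintype_card_le_finrank
  simp at this
  unfold rk at h
  omega

end Rank

/-! ### Rigidity of exponentials that differ from the identity by rank at most one. -/

section Rigidity

variable {K : Type*} [AddCommGroup K] [Module ℝ K] [FiniteDimensional ℝ K]

/-- The identity drops out of a commutator: `[G, B] = [G - 1, B]` is a difference of two maps of
rank at most one. Multiplying by `G⁻¹` does not raise the rank. -/
theorem exists_endExp_commutator_rk_le {A B : Module.End ℝ K} {V : Submodule ℝ (Module.End ℝ K)}
    (hV : ∀ v ∈ V, A * v - v * A ∈ V) (hB : A * B - B * A ∈ V) (h : rk (endExp A - 1) ≤ 1) :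
    ∃ D ∈ V, rk D ≤ 2 ∧ endExp A * B - B * endExp A = D * endExp A := by
  obtain ⟨D, hD, e⟩ := exists_endExp_commutator hV hB
  refine ⟨D, hD, ?_, e⟩
  have h1 : endExp A * endExp (-A) = 1 := by simpa using endExp_neg_mul (-A)
  have h2 : D = (endExp A * B - B * endExp A) * endExp (-A) := by
    rw [e, mul_assoc, h1, mul_one]
  have h3 : endExp A * B - B * endExp A = (endExp A - 1) * B - B * (endExp A - 1) := by
    noncomm_ring
  rw [h2, h3]
  refine (rk_mul_le_left _ _).trans ((rk_sub_le _ _).trans ?_)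
  have h4 := rk_mul_le_left (endExp A - 1) B
  have h5 := rk_mul_le_right B (endExp A - 1)
  omega

/-- The range of `G - 1` is stable under the complex structure `J`, so it cannot be a real line. -/
theorem eq_one_of_commute {G J : Module.End ℝ K} {c : ℝ} (hc : 0 < c) (hJ : J * J = -(c • 1))
    (hG : G * J = J * G) (h : rk (G - 1) ≤ 1) : G = 1 := by
  refine sub_eq_zero.1 (eq_zero_of_rk_le_one (J' := J) hc hJ ?_ h)
  rw [mul_sub, sub_mul, hG, mul_one, one_mul]

end Rigidity

/-! ### Freund--Rubin backgrounds -/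

section FreundRubin

theorem mul_self_of_anticommute {A : Type*} [Ring A] {a b : A} (ha : a * a = 1) (hb : b * b = 1)
    (hab : a * b = -(b * a)) : (a * b) * (a * b) = -1 := by
  calc (a * b) * (a * b) = (a * b) * -(b * a) := by rw [← hab]
    _ = -(a * (b * b) * a) := by noncomm_ring
    _ = -1 := by rw [hb, mul_one, ha]

/-- Both products contract through `b`, to `a * c` and `c * a`. -/
theorem mul_mul_anticommute {A : Type*} [Ring A] {a b c : A} (hb : b * b = 1)
    (hab : a * b = -(b * a)) (hac : a * c = -(c * a)) (hbc : b * c = -(c * b)) :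
    (a * b) * (b * c) = -((b * c) * (a * b)) := by
  have e1 : (a * b) * (b * c) = a * c := by rw [mul_assoc, ← mul_assoc b, hb, one_mul]
  have e2 : (b * c) * (a * b) = c * a := by
    calc (b * c) * (a * b) = (b * c) * -(b * a) := by rw [hab]
      _ = -(b * c) * (b * a) := by noncomm_ring
      _ = (c * b) * (b * a) := by rw [hbc, neg_neg]
      _ = c * (b * b) * a := by noncomm_ring
      _ = c * a := by rw [hb, mul_one]
  rw [e1, e2, hac]

variable {p q : ℕ}

theorem ι_mul_self {i : Fin (p + q)} (hi : (i : ℕ) < p) :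
    CliffordAlgebra.ι (form p q) (basisVec i) * CliffordAlgebra.ι (form p q) (basisVec i) = 1 := by
  rw [CliffordAlgebra.ι_sq_scalar]
  have e : form p q (basisVec i) = 1 := by
    rw [QuadraticMap.weightedSumSquares_apply, Finset.sum_eq_single i]
    · simp [signature, hi]
    · intro b _ hb
      simp [hb]
    · simp
  rw [e, map_one]

theorem ι_mul_ι_of_ne {i j : Fin (p + q)} (hij : i ≠ j) :
    CliffordAlgebra.ι (form p q) (basisVec i) * CliffordAlgebra.ι (form p q) (basisVec j)
      = -(CliffordAlgebra.ι (form p q) (basisVec j) * CliffordAlgebra.ι (form p q) (basisVec i)) := by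
  have := clifford_rel p q i j
  rw [if_neg hij] at this
  exact eq_neg_of_add_eq_zero_left this

theorem ee_mul_self {i j : Fin (p + q)} (hi : (i : ℕ) < p) (hj : (j : ℕ) < p) (hij : i ≠ j) :
    (ee i j : EvenCl p q) * ee i j = -1 :=
  Subtype.ext (mul_self_of_anticommute (ι_mul_self hi) (ι_mul_self hj) (ι_mul_ι_of_ne hij))

theorem ee_anticommute {i j k : Fin (p + q)} (hj : (j : ℕ) < p) (hij : i ≠ j) (hik : i ≠ k)
    (hjk : j ≠ k) : (ee i j : EvenCl p q) * ee j k = -(ee j k * ee i j) :=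
  Subtype.ext (mul_mul_anticommute (ι_mul_self hj) (ι_mul_ι_of_ne hij) (ι_mul_ι_of_ne hik)
    (ι_mul_ι_of_ne hjk))

/-- The bound on `p` provides three directions of square `+1`, hence a quaternionic structure in the
first factor; the bound on `n` provides a complex structure `e₁e₂` in the second. Nothing else about
the two algebras matters. -/
theorem freundRubin_endExp_eq_one {K : Type*} [AddCommGroup K] [Module ℝ K] [FiniteDimensional ℝ K]
    {p n : ℕ} (hp : 3 ≤ p) (hn : 2 ≤ n) (ρ : EvenCl p 2 ⊗[ℝ] EvenCl n 0 →ₐ[ℝ] Module.End ℝ K)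
    (X : so p 2 × so n 0) (h : rk (endExp (freundRubinRep ρ X) - 1) ≤ 1) :
    endExp (freundRubinRep ρ X) = 1 := by
  let r : EvenCl n 0 →ₐ[ℝ] Module.End ℝ K := ρ.comp Algebra.TensorProduct.includeRight
  let l : EvenCl p 2 →ₐ[ℝ] Module.End ℝ K := ρ.comp Algebra.TensorProduct.includeLeft
  have hlr : ∀ x y, l x * r y = r y * l x := fun x y => by
    change ρ (x ⊗ₜ 1) * ρ (1 ⊗ₜ y) = ρ (1 ⊗ₜ y) * ρ (x ⊗ₜ 1)
    rw [← map_mul, ← map_mul]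
    simp
  have hA : freundRubinRep ρ X = l (spin p 2 X.1) + r (spin n 0 X.2) := by
    change ρ (spin p 2 X.1 ⊗ₜ 1 + 1 ⊗ₜ spin n 0 X.2) = _
    rw [map_add]
    rfl
  -- The first summand of the generator commutes with the second factor, so its adjoint action on
  -- that factor is an inner derivation by `spin n 0 X.2`.
  have hV : ∀ y, freundRubinRep ρ X * r y - r y * freundRubinRep ρ X
      ∈ LinearMap.range r.toLinearMap := fun y => by
    refine ⟨spin n 0 X.2 * y - y * spin n 0 X.2, ?_⟩
    rw [hA, add_mul, mul_add, hlr]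
    simp only [AlgHom.toLinearMap_apply, map_sub, map_mul]
    abel
  let a : Fin (n + 0) := ⟨0, by omega⟩
  let b : Fin (n + 0) := ⟨1, by omega⟩
  have hab : (ee a b : EvenCl n 0) * ee a b = -1 :=
    ee_mul_self (by simp [a]; omega) (by simp [b]; omega) (by simp [a, b])
  obtain ⟨D, ⟨y, rfl⟩, hD, e⟩ := exists_endExp_commutator_rk_le
    (by rintro _ ⟨y, rfl⟩; exact hV y) (hV (ee a b)) h
  let i : Fin (p + 2) := ⟨0, by omega⟩
  let j : Fin (p + 2) := ⟨1, by omega⟩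
  let k : Fin (p + 2) := ⟨2, by omega⟩
  have hi : (i : ℕ) < p := by simp [i]; omega
  have hj : (j : ℕ) < p := by simp [j]; omega
  have hk : (k : ℕ) < p := by simp [k]; omega
  have hij : i ≠ j := by simp [i, j]
  have hik : i ≠ k := by simp [i, k]
  have hjk : j ≠ k := by simp [j, k]
  -- The correction term lies in the second factor, so it commutes with the quaternionic structure
  -- of the first; rank at most two then forces it to vanish.
  have h0 : r.toLinearMap y = 0 :=
    eq_zero_of_rk_le_two (I := l (ee i j)) (J := l (ee j k))
      (by rw [← map_mul, ee_mul_self hi hj hij, map_neg, map_one])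
      (by rw [← map_mul, ee_mul_self hj hk hjk, map_neg, map_one])
      (by rw [← map_mul, ee_anticommute hj hij hik hjk, map_neg, map_mul])
      (hlr _ y) (hlr _ y) hD
  rw [h0, zero_mul, sub_eq_zero] at e
  exact eq_one_of_commute one_pos (by rw [← map_mul, hab, map_neg, map_one, one_smul]) e h

end FreundRubin

/-! ### Minkowski spacetime -/

section Minkowski

/-- If `ad A` preserves the span of Clifford generators `W i` of a large enough module, and two of
the generators have squares of the same sign, then `exp A` is not a transvection. -/
theorem endExp_eq_one_of_generators {K : Type*} [AddCommGroup K] [Module ℝ K]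
    [FiniteDimensional ℝ K] (hK : 4 < Module.finrank ℝ K) {ι : Type*} [Fintype ι] [DecidableEq ι]
    {c : ι → ℝ} {W : ι → Module.End ℝ K} (hc : ∀ i, c i ≠ 0)
    (hW : ∀ i j, W i * W j + W j * W i = if i = j then (2 * c i) • 1 else 0)
    {A : Module.End ℝ K}
    (hA : ∀ i, A * W i - W i * A ∈ LinearMap.range (Fintype.linearCombination ℝ W))
    {a b : ι} (hab : a ≠ b) (habc : 0 < c a * c b) (h : rk (endExp A - 1) ≤ 1) :
    endExp A = 1 := by
  have hV : ∀ v ∈ LinearMap.range (Fintype.linearCombination ℝ W),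
      A * v - v * A ∈ LinearMap.range (Fintype.linearCombination ℝ W) := by
    rintro _ ⟨x, rfl⟩
    simp only [Fintype.linearCombination_apply, Finset.mul_sum, Finset.sum_mul, mul_smul_comm,
      smul_mul_assoc, ← Finset.sum_sub_distrib, ← smul_sub]
    exact Submodule.sum_mem _ fun i _ => Submodule.smul_mem _ _ (hA i)
  have hcomm : ∀ i, endExp A * W i = W i * endExp A := fun i => by
    obtain ⟨D, ⟨x, rfl⟩, hD, e⟩ := exists_endExp_commutator_rk_le hV (hA i) h
    -- If the coefficient of `W k` is nonzero, the anticommutator with `W k` is a nonzero scalar, of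
    -- full rank. It is a sum of two products containing `D`, each of rank at most 2, which
    -- contradicts `4 < finrank ℝ K`.
    have hx : x = 0 := by
      by_contra hne
      obtain ⟨k, hk⟩ := Function.ne_iff.1 hne
      have e1 : Fintype.linearCombination ℝ W x * W k + W k * Fintype.linearCombination ℝ W x
          = (x k * (2 * c k)) • 1 := by
        simp only [Fintype.linearCombination_apply, Finset.mul_sum, Finset.sum_mul, mul_smul_comm,
          smul_mul_assoc, ← Finset.sum_add_distrib, ← smul_add, hW]
        simp [mul_smul]
      have e2 := rk_smul_one (K := K) (mul_ne_zero hk (mul_ne_zero two_ne_zero (hc k)))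
      have e3 := rk_add_le (Fintype.linearCombination ℝ W x * W k)
        (W k * Fintype.linearCombination ℝ W x)
      have e4 := rk_mul_le_left (Fintype.linearCombination ℝ W x) (W k)
      have e5 := rk_mul_le_right (W k) (Fintype.linearCombination ℝ W x)
      rw [e1, e2] at e3
      omega
    rwa [hx, map_zero, zero_mul, sub_eq_zero] at e
  have hsq : ∀ i, W i * W i = c i • 1 := fun i => by
    have h1 := hW i i
    rw [if_pos rfl, ← two_smul ℝ, mul_smul] at h1
    exact smul_right_injective _ (two_ne_zero (α := ℝ)) h1
  -- Distinct generators anticommute, so `(W a * W b)² = -(c a * c b)`, which is negative when the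
  -- squares have the same sign.
  refine eq_one_of_commute (J := W a * W b) habc ?_ ?_ h
  · have h1 : W b * W a = -(W a * W b) := by
      have h2 := hW b a
      rw [if_neg hab.symm] at h2
      exact eq_neg_of_add_eq_zero_left h2
    rw [mul_assoc, ← mul_assoc (W b), h1, neg_mul, mul_neg, mul_assoc (W a), ← mul_assoc (W a),
      hsq, hsq, smul_mul_smul_comm, one_mul]
  · rw [← mul_assoc, hcomm, mul_assoc, hcomm, ← mul_assoc]

/-! ### Ordered products of Clifford generators and the volume element. -/

variable {ι A : Type*} [DecidableEq ι] [Ring A] [Algebra ℝ A] {c : ι → ℝ} {g : ι → A}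

theorem gen_mul_prod_of_notMem
    (hg : ∀ i j, g i * g j + g j * g i = if i = j then (2 * c i) • (1 : A) else 0) (i : ι) :
    ∀ l : List ι, i ∉ l →
      g i * (l.map g).prod = (-1 : ℝ) ^ l.length • ((l.map g).prod * g i)
  | [], _ => by simp
  | j :: l, h => by
    rw [List.mem_cons, not_or] at h
    have hij := hg i j
    rw [if_neg h.1] at hij
    rw [List.map_cons, List.prod_cons, ← mul_assoc, eq_neg_of_add_eq_zero_left hij, neg_mul,
      mul_assoc, gen_mul_prod_of_notMem hg i l h.2, List.length_cons, pow_succ, mul_neg_one,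
      neg_smul, mul_smul_comm, mul_assoc]

/-- The generator anticommutes with every factor except itself, giving `length - 1` signs; `length +
1` has the same parity and avoids natural subtraction. -/
theorem gen_mul_prod_of_mem
    (hg : ∀ i j, g i * g j + g j * g i = if i = j then (2 * c i) • (1 : A) else 0) (i : ι) :
    ∀ l : List ι, l.Nodup → i ∈ l →
      g i * (l.map g).prod = (-1 : ℝ) ^ (l.length + 1) • ((l.map g).prod * g i)
  | j :: l, hl, h => by
    rw [List.nodup_cons] at hl
    rw [List.map_cons, List.prod_cons, List.length_cons, pow_succ, pow_succ]
    by_cases hij : i = j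
    · subst hij
      have e := congrArg (g i * ·) (gen_mul_prod_of_notMem hg i l hl.1)
      simp only [mul_smul_comm] at e
      rw [e, mul_neg_one, mul_neg_one, neg_neg, mul_assoc]
    · have hij' := hg i j
      rw [if_neg hij] at hij'
      rw [← mul_assoc, eq_neg_of_add_eq_zero_left hij', neg_mul,
        mul_assoc, gen_mul_prod_of_mem hg i l hl.2 ((List.mem_cons.1 h).resolve_left hij), pow_succ]
      simp [mul_assoc]

theorem prod_mul_self
    (hg : ∀ i j, g i * g j + g j * g i = if i = j then (2 * c i) • (1 : A) else 0)
    (hc : ∀ i, c i ≠ 0) :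
    ∀ l : List ι, l.Nodup → ∃ s : ℝ, s ≠ 0 ∧ (l.map g).prod * (l.map g).prod = s • 1
  | [], _ => ⟨1, one_ne_zero, by simp⟩
  | i :: l, hl => by
    rw [List.nodup_cons] at hl
    obtain ⟨s, hs, e⟩ := prod_mul_self hg hc l hl.2
    have hsq : g i * g i = c i • 1 := by
      have h1 := hg i i
      rw [if_pos rfl, ← two_smul ℝ, mul_smul] at h1
      exact smul_right_injective _ (two_ne_zero (α := ℝ)) h1
    refine ⟨(-1) ^ l.length * (c i * s), mul_ne_zero (by simp) (mul_ne_zero (hc i) hs), ?_⟩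
    have h1 := gen_mul_prod_of_notMem hg i l hl.1
    rw [List.map_cons, List.prod_cons]
    -- Only the first copy of `g i` is moved across the tail, so that it meets the second copy and
    -- the two collapse to `c i`.
    nth_rewrite 1 [h1]
    rw [smul_mul_assoc, mul_assoc, ← mul_assoc (g i), hsq, smul_mul_assoc, one_mul, mul_smul_comm, e,
      smul_smul, smul_smul]
    congr 1
    ring

end Minkowski

/-- The products `eᵢ ω`, with `ω` the volume element, are Clifford generators in `Cℓ⁰(p,q)` on
which `𝔰𝔬(p,q)` acts by the vector representation, for odd `p + q`. -/
theorem exists_even_generators {p q : ℕ} (hpq : Odd (p + q)) :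
    ∃ (s : ℝ) (w : Fin (p + q) → EvenCl p q), s ≠ 0 ∧
    (∀ i j, w i * w j + w j * w i = if i = j then (2 * (signature p q i * s)) • 1 else 0) ∧
    ∀ (X : so p q) i, spin p q X * w i - w i * spin p q X = ∑ a, X.1 a i • w a := by
  let g : Fin (p + q) → CliffordAlgebra (form p q) :=
    fun i => CliffordAlgebra.ι (form p q) (basisVec i)
  let ω := ((List.finRange (p + q)).map g).prod
  have hg : ∀ i j, g i * g j + g j * g i = if i = j then (2 * signature p q i) • 1 else 0 :=
    clifford_rel p q
  have hη : ∀ i, signature p q i ≠ 0 := fun i h0 => by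
    simpa [h0] using signature_mul_self p q i
  -- In odd dimension the sign `(-1) ^ (p + q + 1)` is `+1`, so the volume element is central.
  have hω : ∀ i, g i * ω = ω * g i := fun i => by
    have := gen_mul_prod_of_mem hg i _ (List.nodup_finRange _) (List.mem_finRange i)
    rw [List.length_finRange] at this
    rwa [hpq.add_one.neg_one_pow, one_smul] at this
  obtain ⟨s, hs, hωω⟩ := prod_mul_self hg hη _ (List.nodup_finRange _)
  change ω * ω = _ at hωω
  -- The volume element has odd degree `p + q`, so one further generator makes the degree even.
  have hmem : ∀ i, g i * ω ∈ CliffordAlgebra.even (form p q) := fun i => by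
    have h1 := SetLike.list_prod_map_mem_graded (A := CliffordAlgebra.evenOdd (form p q))
      (List.finRange (p + q)) (fun _ => 1) g
      fun j _ => CliffordAlgebra.ι_mem_evenOdd_one (form p q) (basisVec j)
    have h2 := SetLike.mul_mem_graded
      (CliffordAlgebra.ι_mem_evenOdd_one (form p q) (basisVec i)) h1
    have h3 : 1 + ((List.finRange (p + q)).map fun _ => (1 : ZMod 2)).sum = 0 := by
      rw [List.map_const', List.length_finRange, List.sum_replicate, nsmul_one, add_comm]
      exact_mod_cast (ZMod.natCast_eq_zero_iff_even).2 hpq.add_one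
    rwa [h3] at h2
  let w : Fin (p + q) → EvenCl p q := fun i => ⟨g i * ω, hmem i⟩
  have hw : ∀ i j, w i * w j + w j * w i
      = if i = j then (2 * (signature p q i * s)) • 1 else 0 := fun i j => by
    apply Subtype.ext
    -- Centrality brings the two volume elements together: the relations of the `g i` are rescaled
    -- by `ω² = s`.
    have e : ∀ i j, (g i * ω) * (g j * ω) = s • (g i * g j) := fun i j => by
      rw [hω j, mul_assoc, ← mul_assoc ω, hωω, smul_mul_assoc, one_mul, mul_smul_comm]
    change (g i * ω) * (g j * ω) + (g j * ω) * (g i * ω) = _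
    rw [e, e, ← smul_add, hg]
    split_ifs
    · rw [smul_smul]
      change _ = (2 * (signature p q i * s)) • (1 : CliffordAlgebra (form p q))
      congr 1
      ring
    · simp
  have hspin : ∀ (X : so p q) i, spin p q X * w i - w i * spin p q X
      = ∑ a, X.1 a i • w a := fun X i => by
    apply Subtype.ext
    have hq := quad_lie_gen (signature_mul_self p q) hg (so_skew X) i
    have e1 : ((spin p q X : EvenCl p q) : CliffordAlgebra (form p q))
        = quad (signature p q) g X.1 := coe_quad p q X
    have e2 : quad (signature p q) g X.1 * ω = ω * quad (signature p q) g X.1 := by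
      simp only [quad, Finset.sum_mul, Finset.mul_sum, smul_mul_assoc, mul_smul_comm, mul_assoc, hω]
      simp only [← mul_assoc, hω]
    rw [Subalgebra.coe_sub, Subalgebra.coe_mul, Subalgebra.coe_mul, e1]
    change _ * (g i * ω) - g i * ω * _ = _
    rw [mul_assoc (g i), ← e2, ← mul_assoc, ← mul_assoc, ← sub_mul, hq, Finset.sum_mul,
      AddSubmonoidClass.coe_finsetSum]
    exact Finset.sum_congr rfl fun a _ => smul_mul_assoc _ _ _
  exact ⟨s, w, hs, hw, hspin⟩

/-- Translations act trivially, so only the Lorentz part `X.right` enters; it rotates the span of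
the generators `ρ (w i)`. -/
theorem minkowski_endExp_eq_one {K : Type*} [AddCommGroup K] [Module ℝ K] [FiniteDimensional ℝ K]
    (hK : 4 < Module.finrank ℝ K) (ρ : EvenCl 10 1 →ₐ[ℝ] Module.End ℝ K) (X : Poincare)
    (h : rk (endExp (minkowskiRep ρ X) - 1) ≤ 1) : endExp (minkowskiRep ρ X) = 1 := by
  obtain ⟨s, w, hs, hw, hspin⟩ := exists_even_generators (p := 10) (q := 1) (by decide)
  have hη : ∀ i, signature 10 1 i ≠ 0 := fun i h0 => by
    simpa [h0] using signature_mul_self 10 1 i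
  refine endExp_eq_one_of_generators hK (c := fun i => signature 10 1 i * s)
    (W := fun i => ρ (w i)) (fun i => mul_ne_zero (hη i) hs) (fun i j => ?_) (fun i => ?_)
    -- Directions `0` and `1` both have signature `+1`, so the product of the two squares is `s² >
    -- 0`, whatever the sign of `s`.
    (a := 0) (b := 1) (by decide) ?_ h
  · rw [← map_mul, ← map_mul, ← map_add, hw]
    split_ifs <;> simp
  · refine ⟨fun a => X.right.1 a i, ?_⟩
    change _ = ρ (spin 10 1 X.right) * ρ (w i) - ρ (w i) * ρ (spin 10 1 X.right)
    rw [← map_mul, ← map_mul, ← map_sub, hspin, map_sum, Fintype.linearCombination_apply]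
    simp only [map_smul]
  · have : 0 < s * s := mul_self_pos.2 hs
    simpa [signature] using hs

/-! ### The Cahen--Wallach wave -/

/-! ### Commutators with the image of the wave algebra. -/

section WaveAlgebraic

variable {A : Type*} [Ring A] [Algebra ℝ A] {P M : A} {g : Transverse → A}

theorem map_triple {B : Type*} [Ring B] [Algebra ℝ B] (ρ : A →ₐ[ℝ] B) :
    ρ (triple g) = triple (fun i => ρ (g i)) := by
  simp [triple]

theorem map_imWave {B : Type*} [Ring B] [Algebra ℝ B] (ρ : A →ₐ[ℝ] B) (μ : ℝ)
    (Z : CahenWallach μ) (X : Rotations) :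
    ρ (imWave μ P M g Z X) = imWave μ (ρ P) (ρ M) (fun i => ρ (g i)) Z X := by
  simp only [imWave, imNil, imMinus, imE, imEStar, quad, map_add, map_sub, map_sum, map_smul,
    map_mul, map_triple]

theorem WittRelations.map {B : Type*} [Ring B] [Algebra ℝ B] (h : WittRelations P M g)
    (ρ : A →ₐ[ℝ] B) : WittRelations (ρ P) (ρ M) (fun i => ρ (g i)) where
  PP := by rw [← map_mul, h.PP, map_zero]
  MM := by rw [← map_mul, h.MM, map_zero]
  MP := by rw [← map_mul, ← map_mul, h.MP, map_sub, map_ofNat]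
  Pg i := by rw [← map_mul, h.Pg, map_neg, map_mul]
  Mg i := by rw [← map_mul, h.Mg, map_neg, map_mul]
  gg i j := by
    rw [← map_mul, ← map_mul, ← map_add, h.gg]
    split_ifs <;> simp

theorem sum_smul_mul_sum_smul {ι κ : Type*} [Fintype ι] [Fintype κ] (a : ι → ℝ) (b : κ → ℝ)
    (u : ι → A) (v : κ → A) :
    (∑ k, a k • u k) * ∑ i, b i • v i = ∑ k, ∑ i, (a k * b i) • (u k * v i) := by
  simp only [Finset.sum_mul_sum, smul_mul_smul_comm]

/-- Puts the opposite product into the same double sum with the same coefficients, so that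
commutators and anticommutators can be taken term by term. -/
theorem sum_smul_mul_sum_smul' {ι κ : Type*} [Fintype ι] [Fintype κ] (a : ι → ℝ) (b : κ → ℝ)
    (u : ι → A) (v : κ → A) :
    (∑ i, b i • v i) * ∑ k, a k • u k = ∑ k, ∑ i, (a k * b i) • (v i * u k) := by
  rw [sum_smul_mul_sum_smul, Finset.sum_comm]
  simp only [mul_comm]

namespace WittRelations

variable (μ : ℝ)

theorem imNil_mul_P (h : WittRelations P M g) (x y : Transverse → ℝ) :
    imNil μ P g x y * P = 0 := by
  simp only [imNil, imE, imEStar, add_mul, Finset.sum_mul, smul_mul_assoc, mul_assoc, h.PP,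
    mul_zero, smul_zero, Finset.sum_const_zero, add_zero]

theorem P_mul_imNil (h : WittRelations P M g) (x y : Transverse → ℝ) :
    P * imNil μ P g x y = 0 := by
  simp only [imNil, imE, imEStar, mul_add, Finset.mul_sum, mul_smul_comm, mul_assoc,
    anti_tail h.P_triple, anti_tail (h.Pg _), h.PP,
    mul_zero, smul_zero, neg_zero, Finset.sum_const_zero, add_zero]

/-- `½ P M` is the projection `Π₊`, and nilpotent elements take values in its range. -/
theorem PM_mul_imNil (h : WittRelations P M g) (x y : Transverse → ℝ) :
    P * M * imNil μ P g x y = (2 : ℝ) • imNil μ P g x y := by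
  simp only [imNil, imE, imEStar, mul_add, Finset.mul_sum, mul_smul_comm, mul_assoc,
    anti_tail h.P_triple, anti_tail (h.Pg _), anti_tail h.M_triple, anti_tail (h.Mg _), mul_neg,
    neg_neg, h.PMP, smul_add, Finset.smul_sum]
  simp only [smul_comm (2 : ℝ)]

/-- Nilpotent elements annihilate `P` on both sides and rotations commute with it, so only `e₋`
contributes. The frequency `μ / 3` is `μ / 4 + μ / 12`, the sum of the coefficients of `Π₊` and
`Π₋`. Together with `imWave_triple_P`, this says that the adjoint action rotates the plane of `P`
and `triple g * P`. -/
theorem imWave_P (h : WittRelations P M g) (Z : CahenWallach μ) (X : Rotations) :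
    imWave μ P M g Z X * P - P * imWave μ P M g Z X = (-(Z.minus * (μ / 3))) • (triple g * P) := by
  have hE : imMinus μ P M g * P - P * imMinus μ P M g = (-(μ / 3)) • (triple g * P) := by
    simp only [imMinus, sub_mul, mul_sub, smul_mul_assoc, mul_smul_comm, mul_assoc,
      anti_tail h.P_triple, h.PP, h.P_tail, h.PMP, mul_zero, neg_zero, smul_zero, smul_neg,
      smul_smul]
    module
  rw [imWave, add_mul, mul_add, add_mul, mul_add, h.imNil_mul_P, h.P_mul_imNil,
    quad_comm_of_anti h.Pg, smul_mul_assoc, mul_smul_comm, zero_add, zero_add, add_sub_add_right_eq_sub,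
    ← smul_sub, hE, smul_smul]
  congr 1
  ring

theorem imWave_triple_P (h : WittRelations P M g) (Z : CahenWallach μ) (X : Rotations) :
    imWave μ P M g Z X * (triple g * P) - triple g * P * imWave μ P M g Z X
      = (Z.minus * (μ / 3)) • P := by
  have hE : imMinus μ P M g * (triple g * P) - triple g * P * imMinus μ P M g = (μ / 3) • P := by
    simp only [imMinus, sub_mul, mul_sub, smul_mul_assoc, mul_smul_comm, mul_assoc,
      anti_tail h.P_triple, anti_tail h.M_triple, h.triple_tail, mul_neg, neg_neg, h.PP, h.P_tail,
      h.PMP, mul_zero, neg_zero, smul_zero, smul_neg, smul_smul]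
    module
  have e1 : imNil μ P g Z.e Z.eStar * (triple g * P) = 0 := by
    have : triple g * P = -(P * triple g) := by rw [h.P_triple, neg_neg]
    rw [this, mul_neg, ← mul_assoc, h.imNil_mul_P, zero_mul, neg_zero]
  have e2 : triple g * P * imNil μ P g Z.e Z.eStar = 0 := by
    rw [mul_assoc, h.P_mul_imNil, mul_zero]
  have e3 : quad (fun _ => 1) g (blockMatrix X) * (triple g * P)
      = triple g * P * quad (fun _ => 1) g (blockMatrix X) := by
    rw [← mul_assoc, h.quad_triple, mul_assoc, quad_comm_of_anti h.Pg, mul_assoc]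
  rw [imWave, add_mul, mul_add, add_mul, mul_add, e1, e2, e3, smul_mul_assoc, mul_smul_comm,
    zero_add, zero_add, add_sub_add_right_eq_sub, ← smul_sub, hE, smul_smul]

/-- The images of `e₋` and of rotations preserve the splitting by `Π₊` and `Π₋`. A nilpotent element
`N` satisfies `N P M = 0` and `P M N = 2 N`, whence the factor `-2`. -/
theorem imWave_PM (h : WittRelations P M g) (Z : CahenWallach μ) (X : Rotations) :
    imWave μ P M g Z X * (P * M) - P * M * imWave μ P M g Z X
      = (-2 : ℝ) • imNil μ P g Z.e Z.eStar := by
  have hE : imMinus μ P M g * (P * M) = P * M * imMinus μ P M g := by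
    have hMM : ∀ x, M * (M * x) = 0 := fun x => by rw [← mul_assoc, h.MM, zero_mul]
    simp only [imMinus, sub_mul, mul_sub, smul_mul_assoc, mul_smul_comm, mul_assoc,
      anti_tail h.P_triple, anti_tail h.M_triple, mul_neg, neg_neg, h.P_tail, hMM,
      h.PMP_tail, mul_zero, neg_zero, smul_zero]
  have e3 : quad (fun _ => 1) g (blockMatrix X) * (P * M)
      = P * M * quad (fun _ => 1) g (blockMatrix X) := by
    rw [← mul_assoc, quad_comm_of_anti h.Pg, mul_assoc, quad_comm_of_anti h.Mg, mul_assoc]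
  have e4 : imNil μ P g Z.e Z.eStar * (P * M) = 0 := by
    rw [← mul_assoc, h.imNil_mul_P, zero_mul]
  rw [imWave, add_mul, mul_add, add_mul, mul_add, e3, smul_mul_assoc, mul_smul_comm, hE,
    h.PM_mul_imNil, e4]
  module

/-- The commutator of an element of the symmetry algebra with a nilpotent element. -/
theorem imWave_imNil (h : WittRelations P M g) (Z : CahenWallach μ) (X : Rotations)
    (x y : Transverse → ℝ) :
    imWave μ P M g Z X * imNil μ P g x y - imNil μ P g x y * imWave μ P M g Z X
      = Z.minus • imNil μ P g (fun i => -(freq μ i ^ 2) * y i) x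
        + imNil μ P g ((blockMatrix X).mulVec x) ((blockMatrix X).mulVec y) := by
  rw [← h.lie_imNil, ← h.quad_imNil, imWave, add_mul, mul_add, add_mul, mul_add, h.imNil_mul,
    h.imNil_mul, smul_mul_assoc, mul_smul_comm, smul_sub]
  abel

variable {μ}

/-- A vector `∑ αₖ g₃₊ₖ` orthogonal to `x` anticommutes with the image of `∑ xᵢ eᵢ`. -/
theorem vector_imE (h : WittRelations P M g) {α : Fin 6 → ℝ} {x : Transverse → ℝ}
    (hα : ∑ k, α k * x (.inr k) = 0) :
    (∑ k, α k • g (.inr k)) * ∑ i, x i • imE μ P g i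
      = -((∑ i, x i • imE μ P g i) * ∑ k, α k • g (.inr k)) := by
  -- Only the matching index survives, and its value does not depend on `k`. The double sum is
  -- therefore the scalar product of `α` with the last six components of `x`, times a fixed element.
  have e : ∀ k i, g (.inr k) * imE μ P g i + imE μ P g i * g (.inr k)
      = if i = .inr k then (μ / 6) • (triple g * P) else 0 := fun k i => by
    have h1 : g (.inr k) * imE μ P g i + imE μ P g i * g (.inr k)
        = (1 / 2 * freq μ i) • (triple g * (g i * g (.inr k) + g (.inr k) * g i) * P) := by
      simp only [imE, smul_mul_assoc, mul_smul_comm, mul_assoc, h.Pg, h.g_triple_tail, sgn,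
        Sum.elim_inr, mul_neg, mul_add, add_mul]
      module
    rw [h1, h.gg]
    split_ifs with hik
    · subst hik
      simp only [freq, Sum.elim_inr, mul_smul_comm, smul_mul_assoc, mul_one, smul_smul]
      congr 1
      ring
    · simp
  rw [eq_neg_iff_add_eq_zero, sum_smul_mul_sum_smul, sum_smul_mul_sum_smul', ← Finset.sum_add_distrib]
  simp only [← Finset.sum_add_distrib, ← smul_add, e]
  simp [← Finset.sum_smul, smul_smul, ← Finset.sum_mul, hα]

/-- A vector `∑ αₖ g₃₊ₖ` orthogonal to `y` commutes with the image of `∑ yᵢ eᵢ*`. -/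
theorem vector_imEStar (h : WittRelations P M g) {α : Fin 6 → ℝ} {y : Transverse → ℝ}
    (hα : ∑ k, α k * y (.inr k) = 0) :
    (∑ k, α k • g (.inr k)) * ∑ i, y i • imEStar μ P g i
      = (∑ i, y i • imEStar μ P g i) * ∑ k, α k • g (.inr k) := by
  -- There is no factor `triple g` to cross here, which costs one sign relative to `vector_imE`: the
  -- commutator replaces the anticommutator.
  have e : ∀ k i, g (.inr k) * imEStar μ P g i - imEStar μ P g i * g (.inr k)
      = if i = .inr k then (-((μ / 6) ^ 2)) • P else 0 := fun k i => by
    have h1 : g (.inr k) * imEStar μ P g i - imEStar μ P g i * g (.inr k)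
        = (-(1 / 2) * freq μ i ^ 2) • ((g i * g (.inr k) + g (.inr k) * g i) * P) := by
      simp only [imEStar, smul_mul_assoc, mul_smul_comm, mul_assoc, h.Pg, mul_neg, add_mul]
      module
    rw [h1, h.gg]
    split_ifs with hik
    · subst hik
      simp only [freq, Sum.elim_inr, smul_mul_assoc, mul_one, one_mul, smul_smul]
      congr 1
      ring
    · simp
  rw [← sub_eq_zero, sum_smul_mul_sum_smul, sum_smul_mul_sum_smul', ← Finset.sum_sub_distrib]
  simp only [← Finset.sum_sub_distrib, ← smul_sub, e]
  simp [← Finset.sum_smul, smul_smul, ← Finset.sum_mul, hα]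

theorem exists_ne_zero_dotProduct_eq_zero {m n : ℕ} (hmn : m < n) (v : Fin m → Fin n → ℝ) :
    ∃ α : Fin n → ℝ, α ≠ 0 ∧ ∀ i, ∑ k, α k * v i k = 0 := by
  have h : LinearMap.ker (Matrix.mulVecLin (Matrix.of v)) ≠ ⊥ :=
    LinearMap.ker_ne_bot_of_finrank_lt (by simpa using hmn)
  obtain ⟨α, hα, hne⟩ := Submodule.exists_mem_ne_zero_of_ne_bot h
  refine ⟨α, hne, fun i => ?_⟩
  have := congrFun (LinearMap.mem_ker.1 hα) i
  simpa [Matrix.mulVec, dotProduct, mul_comm] using this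

/-- The image of a nilpotent element commutes with a complex structure. -/
theorem exists_complexStructure_imNil (h : WittRelations P M g) (x y : Transverse → ℝ) :
    ∃ (J : A) (c : ℝ), 0 < c ∧ J * J = -(c • 1) ∧ J * imNil μ P g x y = imNil μ P g x y * J := by
  -- Two independent vectors of `ℝ⁶` are wanted, orthogonal to `x`, `y` and to each other: two, then
  -- three, linear conditions on six coordinates.
  obtain ⟨α, hα0, hα⟩ := exists_ne_zero_dotProduct_eq_zero (by norm_num : 2 < 6)
    ![fun k => x (.inr k), fun k => y (.inr k)]
  obtain ⟨β, hβ0, hβ⟩ := exists_ne_zero_dotProduct_eq_zero (by norm_num : 3 < 6)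
    ![fun k => x (.inr k), fun k => y (.inr k), α]
  have hrel : ∀ i j : Fin 6, g (.inr i) * g (.inr j) + g (.inr j) * g (.inr i)
      = if i = j then (2 * 1 : ℝ) • (1 : A) else 0 := fun i j => by
    rw [h.gg]; simp
  have hpos : ∀ v : Fin 6 → ℝ, v ≠ 0 → 0 < ∑ i, 1 * (v i * v i) := fun v hv => by
    obtain ⟨k, hk⟩ := Function.ne_iff.1 hv
    exact Finset.sum_pos' (fun i _ => by nlinarith [mul_self_nonneg (v i)])
      ⟨k, Finset.mem_univ k, by simpa using mul_self_pos.2 hk⟩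
  have hff := sum_gen_sq hrel α
  have hhh := sum_gen_sq hrel β
  have hfh : (∑ k, β k • g (.inr k)) * (∑ k, α k • g (.inr k))
      = -((∑ k, α k • g (.inr k)) * ∑ k, β k • g (.inr k)) := by
    have e : (∑ k, β k • g (.inr k)) * (∑ k, α k • g (.inr k))
        + (∑ k, α k • g (.inr k)) * (∑ k, β k • g (.inr k)) = (2 * ∑ k, β k * α k) • 1 := by
      rw [sum_smul_mul_sum_smul, sum_smul_mul_sum_smul', ← Finset.sum_add_distrib]
      simp only [← Finset.sum_add_distrib, ← smul_add, hrel]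
      simp [Finset.mul_sum, Finset.sum_smul, smul_smul, mul_comm]
    have h2 : ∑ k, β k * α k = 0 := hβ 2
    rw [h2, mul_zero, zero_smul] at e
    exact eq_neg_of_add_eq_zero_left e
  have a1 := h.vector_imE (μ := μ) (hα 0)
  have a2 := h.vector_imEStar (μ := μ) (hα 1)
  have b1 := h.vector_imE (μ := μ) (hβ 0)
  have b2 := h.vector_imEStar (μ := μ) (hβ 1)
  refine ⟨(∑ k, α k • g (.inr k)) * ∑ k, β k • g (.inr k), _, mul_pos (hpos α hα0) (hpos β hβ0),
    ?_, ?_⟩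
  · rw [mul_assoc, ← mul_assoc (∑ k, β k • g (.inr k)), hfh, neg_mul, mul_neg, mul_assoc, hhh,
      ← mul_assoc, hff, smul_mul_smul_comm, one_mul]
  -- Both vectors anticommute with the `eᵢ` part and both commute with the `eᵢ*` part; in either
  -- case their product commutes.
  · rw [imNil, mul_add, add_mul]
    congr 1
    · rw [mul_assoc, b1, mul_neg, ← mul_assoc, a1, neg_mul, neg_neg, mul_assoc]
    · rw [mul_assoc, b2, ← mul_assoc, a2, mul_assoc]

end WittRelations

end WaveAlgebraic

/-! ### Rigidity for the wave. -/

section WaveRigidity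

variable {K : Type*} [AddCommGroup K] [Module ℝ K] [FiniteDimensional ℝ K] {P M : Module.End ℝ K}
  {g : Transverse → Module.End ℝ K}

/-- Since `triple g` squares to `-1`, multiplying `a P + b (triple g * P)` by `a - b triple g` gives
`(a² + b²) P`. The anticommutator of `P` with `M` is `2`, so a nonzero scalar would be a sum of two
maps of rank at most `rk D`, forcing dimension at most 4. -/
theorem WittRelations.eq_zero_of_mem_span (h : WittRelations P M g)
    (hK : 4 < Module.finrank ℝ K) {D : Module.End ℝ K}
    (hD : D ∈ Submodule.span ℝ {P, triple g * P}) (hr : rk D ≤ 2) : D = 0 := by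
  obtain ⟨a, b, rfl⟩ := Submodule.mem_span_pair.1 hD
  by_contra hne
  have hab : a * a + b * b ≠ 0 := fun h0 => by
    have ha : a = 0 := by nlinarith [mul_self_nonneg a, mul_self_nonneg b]
    have hb : b = 0 := by nlinarith [mul_self_nonneg a, mul_self_nonneg b]
    exact hne (by simp [ha, hb])
  have e : (a • 1 - b • triple g) * (a • P + b • (triple g * P)) = (a * a + b * b) • P := by
    simp only [sub_mul, mul_add, smul_mul_assoc, mul_smul_comm, one_mul, h.triple_tail]
    module
  have e1 : ((a * a + b * b) * 2) • (1 : Module.End ℝ K)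
      = (a • 1 - b • triple g) * (a • P + b • (triple g * P)) * M
        + M * ((a • 1 - b • triple g) * (a • P + b • (triple g * P))) := by
    rw [e, smul_mul_assoc, mul_smul_comm, h.MP, ← smul_add, add_sub_cancel, mul_smul, two_smul ℝ,
      one_add_one_eq_two]
  have e2 := rk_smul_one (K := K) (mul_ne_zero hab two_ne_zero)
  rw [e1] at e2
  set D := a • P + b • (triple g * P)
  have e3 := rk_add_le ((a • 1 - b • triple g) * D * M) (M * ((a • 1 - b • triple g) * D))
  have e4 := rk_mul_le_left ((a • 1 - b • triple g) * D) M
  have e5 := rk_mul_le_right M ((a • 1 - b • triple g) * D)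
  have e6 := rk_mul_le_right (a • 1 - b • triple g) D
  omega

theorem WittRelations.endExp_eq_one (h : WittRelations P M g) (hK : 4 < Module.finrank ℝ K) (μ : ℝ)
    (Z : CahenWallach μ) (X : Rotations) (hr : rk (endExp (imWave μ P M g Z X) - 1) ≤ 1) :
    endExp (imWave μ P M g Z X) = 1 := by
  have hP : imWave μ P M g Z X * P - P * imWave μ P M g Z X
      ∈ Submodule.span ℝ {P, triple g * P} := by
    rw [h.imWave_P]
    exact Submodule.smul_mem _ _ (Submodule.subset_span (by simp))
  have hTP : imWave μ P M g Z X * (triple g * P) - triple g * P * imWave μ P M g Z X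
      ∈ Submodule.span ℝ {P, triple g * P} := by
    rw [h.imWave_triple_P]
    exact Submodule.smul_mem _ _ (Submodule.subset_span (by simp))
  have hV : ∀ v ∈ Submodule.span ℝ {P, triple g * P},
      imWave μ P M g Z X * v - v * imWave μ P M g Z X
        ∈ Submodule.span ℝ {P, triple g * P} := fun v hv => by
    obtain ⟨a, b, rfl⟩ := Submodule.mem_span_pair.1 hv
    have := Submodule.add_mem _ (Submodule.smul_mem _ a hP) (Submodule.smul_mem _ b hTP)
    convert this using 1
    simp only [mul_add, add_mul, smul_mul_assoc, mul_smul_comm, smul_sub]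
    abel
  -- The range of `L` is the image of all `eᵢ` and `eᵢ*`, the stable space into which `P * M` is
  -- sent.
  let L : (Transverse → ℝ) × (Transverse → ℝ) →ₗ[ℝ] Module.End ℝ K :=
    (Fintype.linearCombination ℝ (imE μ P g)).coprod (Fintype.linearCombination ℝ (imEStar μ P g))
  have hL : ∀ x y, L (x, y) = imNil μ P g x y := fun _ _ => rfl
  have hN : ∀ x y, imNil μ P g x y ∈ LinearMap.range L := fun x y => ⟨(x, y), rfl⟩
  obtain ⟨D₁, hD₁, hr₁, e₁⟩ := exists_endExp_commutator_rk_le hV hP hr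
  obtain ⟨D₂, hD₂, hr₂, e₂⟩ := exists_endExp_commutator_rk_le hV hTP hr
  -- The general rank bound 2 would be too weak here, because only one complex structure will be
  -- available; rank at most one is obtained below from `N * P = 0`.
  obtain ⟨D₃, ⟨⟨x, y⟩, rfl⟩, e₃⟩ := exists_endExp_commutator (A := imWave μ P M g Z X)
    (B := P * M) (V := LinearMap.range L)
    (by
      rintro _ ⟨⟨x, y⟩, rfl⟩
      rw [hL, h.imWave_imNil]
      exact Submodule.add_mem _ (Submodule.smul_mem _ _ (hN _ _)) (hN _ _))
    (by
      rw [h.imWave_PM]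
      exact Submodule.smul_mem _ _ (hN _ _))
  rw [h.eq_zero_of_mem_span hK hD₁ hr₁, zero_mul] at e₁
  rw [h.eq_zero_of_mem_span hK hD₂ hr₂, zero_mul] at e₂
  have hinv : endExp (imWave μ P M g Z X) * endExp (-imWave μ P M g Z X) = 1 := by
    simpa using endExp_neg_mul (-imWave μ P M g Z X)
  generalize endExp (-imWave μ P M g Z X) = G' at hinv
  generalize endExp (imWave μ P M g Z X) = G at *
  obtain ⟨N, rfl⟩ : ∃ N, G = 1 + N := ⟨G - 1, by abel⟩
  rw [add_sub_cancel_left] at hr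
  have hNP : N * P = P * N := by
    rw [← sub_eq_zero, ← e₁]
    noncomm_ring
  have hNTP : N * (triple g * P) = triple g * P * N := by
    rw [← sub_eq_zero, ← e₂]
    noncomm_ring
  -- Commuting with `P` and with `triple g * P` gives `triple g * (N * P) = N * (triple g * P)`.
  -- Since `P` and `triple g` anticommute, this is `(N * P) * (-triple g)`.
  have hNP0 : N * P = 0 :=
    eq_zero_of_rk_le_one (J := triple g) (J' := -triple g) one_pos
      (by rw [h.triple_sq, one_smul])
      (by rw [hNP, ← mul_assoc, ← hNTP, ← neg_neg (triple g * P), ← h.P_triple, mul_neg, mul_neg,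
            ← mul_assoc, hNP])
      ((rk_mul_le_left N P).trans hr)
  have hPN0 : P * N = 0 := by rw [← hNP, hNP0]
  -- As `N * P = 0`, the commutator of `1 + N` with `P * M` reduces to `-(P * M) * N`.
  have e4 : imNil μ P g x y * (1 + N) = -(P * M) * N := by
    rw [← hL, ← e₃, add_mul, mul_add, one_mul, mul_one, ← mul_assoc N, hNP0, zero_mul, neg_mul]
    abel
  have e5 : imNil μ P g x y = -(P * M) * N * G' := by
    rw [← e4, mul_assoc, hinv, mul_one]
  obtain ⟨J, c, hc, hJ, hJN⟩ := h.exists_complexStructure_imNil (μ := μ) x y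
  have e6 : imNil μ P g x y = 0 := by
    refine eq_zero_of_rk_le_one hc hJ hJN ?_
    rw [e5]
    exact (rk_mul_le_left _ _).trans ((rk_mul_le_right _ _).trans hr)
  rw [e6, zero_mul, neg_mul, zero_eq_neg] at e4
  -- `M * P + P * M = 2`, and both terms annihilate `N` from the left.
  have e7 : (2 : ℝ) • N = 0 := by
    have : (2 : Module.End ℝ K) = M * P + P * M := by rw [h.MP, sub_add_cancel]
    calc (2 : ℝ) • N = 2 * N := by rw [two_smul, two_mul]
      _ = M * (P * N) + P * M * N := by rw [this, add_mul, mul_assoc M]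
      _ = 0 := by rw [hPN0, e4, mul_zero, add_zero]
  rw [(smul_eq_zero.1 e7).resolve_left two_ne_zero, add_zero]

theorem wave_endExp_eq_one (hK : 4 < Module.finrank ℝ K) (μ : ℝ)
    (ρ : WaveCl →ₐ[ℝ] Module.End ℝ K) (X : WaveAlgebra μ)
    (h : rk (endExp (waveRep μ ρ X) - 1) ≤ 1) : endExp (waveRep μ ρ X) = 1 := by
  have e : waveRep μ ρ X
      = imWave μ (ρ gammaPlus) (ρ gammaMinus) (fun i => ρ (gamma i)) X.left X.right :=
    map_imWave ρ μ X.left X.right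
  rw [e] at h ⊢
  exact (wittRelations.map ρ).endExp_eq_one hK μ X.left X.right h

end WaveRigidity

end MaxSusy

end

/-- Each case reduces, through `rk_sub_one_le`, to the rigidity statement for its background. -/
theorem mainTheorem2 {K : Type*} [AddCommGroup K] [Module ℝ K] [FiniteDimensional ℝ K]
    (hK : Module.finrank ℝ K = 32) :
    -- Minkowski
    (∀ (ρ : MaxSusy.EvenCl 10 1 →ₐ[ℝ] Module.End ℝ K) (X : MaxSusy.Poincare),
      31 ≤ Module.finrank ℝ
        (MaxSusy.invariants (MaxSusy.endExp (MaxSusy.minkowskiRep ρ X))) →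
      MaxSusy.endExp (MaxSusy.minkowskiRep ρ X) = 1) ∧
    -- AdS₄ × S⁷
    (∀ (ρ : MaxSusy.EvenCl 3 2 ⊗[ℝ] MaxSusy.EvenCl 8 0 →ₐ[ℝ] Module.End ℝ K),
      ρ (1 ⊗ₜ MaxSusy.volume8 rfl) = -1 →
      ∀ X : MaxSusy.so 3 2 × MaxSusy.so 8 0,
      31 ≤ Module.finrank ℝ
        (MaxSusy.invariants (MaxSusy.endExp (MaxSusy.freundRubinRep ρ X))) →
      MaxSusy.endExp (MaxSusy.freundRubinRep ρ X) = 1) ∧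
    -- AdS₇ × S⁴
    (∀ (ρ : MaxSusy.EvenCl 6 2 ⊗[ℝ] MaxSusy.EvenCl 5 0 →ₐ[ℝ] Module.End ℝ K),
      ρ (MaxSusy.volume8 rfl ⊗ₜ 1) = -1 →
      ∀ X : MaxSusy.so 6 2 × MaxSusy.so 5 0,
      31 ≤ Module.finrank ℝ
        (MaxSusy.invariants (MaxSusy.endExp (MaxSusy.freundRubinRep ρ X))) →
      MaxSusy.endExp (MaxSusy.freundRubinRep ρ X) = 1) ∧
    -- the wave
    (∀ (μ : ℝ), μ ≠ 0 → ∀ (ρ : MaxSusy.WaveCl →ₐ[ℝ] Module.End ℝ K) (X : MaxSusy.WaveAlgebra μ),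
      31 ≤ Module.finrank ℝ
        (MaxSusy.invariants (MaxSusy.endExp (MaxSusy.waveRep μ ρ X))) →
      MaxSusy.endExp (MaxSusy.waveRep μ ρ X) = 1) := by
  have hK4 : 4 < Module.finrank ℝ K := by omega
  exact ⟨fun ρ X h => MaxSusy.minkowski_endExp_eq_one hK4 ρ X (MaxSusy.rk_sub_one_le hK h),
    fun ρ _ X h => MaxSusy.freundRubin_endExp_eq_one (by norm_num) (by norm_num) ρ X
      (MaxSusy.rk_sub_one_le hK h),
    fun ρ _ X h => MaxSusy.freundRubin_endExp_eq_one (by norm_num) (by norm_num) ρ X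
      (MaxSusy.rk_sub_one_le hK h),
    fun μ _ ρ X h => MaxSusy.wave_endExp_eq_one hK4 μ ρ X (MaxSusy.rk_sub_one_le hK h)⟩
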